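/- Let $\mathscr{C}$ be a biclique-free class of finite simple graphs, i.e. there is a number $d$ such that no graph in $\mathscr{C}$ contains the complete bipartite graph $K_{d,d}$ as a (not necessarily induced) subgraph. Then \textsc{Dominating Set Discovery}, parameterized by the number $k$ of tokens, has a polynomial kernel on $\mathscr{C}$. Here an instance of \textsc{Dominating Set Discovery} is a triple $(G,S,b)$ consisting of a graph $G$, a set $S\subseteq V(G)$ with $|S|=k$, and a budget $b\in\mathbb{N}$, encoded in binary. It is a yes-instance if there are $\ell\le b$ and sets $C_0,\dots,C_\ell\subseteq V(G)$ such that $C_0=S$, $C_\ell$ is a dominating set of $G$, and for each $i<\ell$ one has $C_{i+1}=(C_i\setminus\{y\})\cup\{x\}$ for some $y\in C_i$ and $x\notin C_i$ with $xy\in E(G)$. A polynomial kernel on $\mathscr{C}$ is an algorithm which, given an instance $(G,S,b)$ with $G\in\mathscr{C}$, computes in time polynomial in the size of the instance an instance $(G',S',b')$ such that $(G',S',b')$ is a yes-instance if and only if $(G,S,b)$ is, the size of $(G',S',b')$ and its parameter $k'=|S'|$ are bounded by a polynomial in $k=|S|$, and $G'$ is isomorphic to an induced subgraph of a graph in $\mathscr{C}$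 (so that $G'\in\mathscr{C}$ if $\mathscr{C}$ is closed under induced subgraphs and isomorphism). The algorithm and the polynomials may depend on $\mathscr{C}$, but not on the instance. -/

import Mathlib

namespace DSDiscovery

/-! ## The machine model: a random access machine with structured programs

The memory is a map `ℕ → ℕ`.  Expressions allow constants, (indirect) reading, addition and
truncated subtraction, each at unit cost.  There is no unit-cost multiplication, so that after `t`
steps all numbers have at most `O(t)` bits more than the input numbers; running times on this
machine and on a multi-tape Turing machine are therefore polynomially related. -/

/-- The contents of the memory. -/
abbrev Memory : Type := ℕ → ℕ

/-- Arithmetic expressions. -/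
inductive Expr : Type
  /-- a constant -/
  | lit (c : ℕ) : Expr
  /-- the contents of the cell whose address is the value of `e` -/
  | read (e : Expr) : Expr
  | add (e₁ e₂ : Expr) : Expr
  /-- truncated subtraction -/
  | sub (e₁ e₂ : Expr) : Expr

/-- The value of an expression in a memory. -/
def Expr.val (m : Memory) : Expr → ℕ
  | .lit c => c
  | .read e => m (e.val m)
  | .add e₁ e₂ => e₁.val m + e₂.val m
  | .sub e₁ e₂ => e₁.val m - e₂.val m

/-- The number of steps needed to evaluate an expression: one for each of its operations. -/
def Expr.cost : Expr → ℕ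
  | .lit _ => 1
  | .read e => e.cost + 1
  | .add e₁ e₂ => e₁.cost + e₂.cost + 1
  | .sub e₁ e₂ => e₁.cost + e₂.cost + 1

/-- Programs. -/
inductive Program : Type
  | skip : Program
  /-- write the value of `e` into the cell whose address is the value of `a` -/
  | write (a e : Expr) : Program
  | seq (P Q : Program) : Program
  /-- execute `P` if the value of `e` is nonzero, and `Q` otherwise -/
  | cond (e : Expr) (P Q : Program) : Program
  /-- as long as the value of `e` is nonzero, execute `P` -/
  | loop (e : Expr) (P : Program) : Program

/-- `Exec P m t m'`: started on the memory `m`, the program `P` halts after exactly `t` steps, with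
memory `m'`. -/
inductive Exec : Program → Memory → ℕ → Memory → Prop
  | skip (m : Memory) : Exec .skip m 1 m
  | write (a e : Expr) (m : Memory) :
      Exec (.write a e) m (a.cost + e.cost + 1) (Function.update m (a.val m) (e.val m))
  | seq {P Q : Program} {m₁ m₂ m₃ : Memory} {s t : ℕ} :
      Exec P m₁ s m₂ → Exec Q m₂ t m₃ → Exec (.seq P Q) m₁ (s + t) m₃
  | cond_pos {e : Expr} {P Q : Program} {m m' : Memory} {t : ℕ} :
      e.val m ≠ 0 → Exec P m t m' → Exec (.cond e P Q) m (e.cost + 1 + t) m'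
  | cond_zero {e : Expr} {P Q : Program} {m m' : Memory} {t : ℕ} :
      e.val m = 0 → Exec Q m t m' → Exec (.cond e P Q) m (e.cost + 1 + t) m'
  | loop_pos {e : Expr} {P : Program} {m₁ m₂ m₃ : Memory} {s t : ℕ} :
      e.val m₁ ≠ 0 → Exec P m₁ s m₂ → Exec (.loop e P) m₂ t m₃ →
        Exec (.loop e P) m₁ (e.cost + 1 + s + t) m₃
  | loop_zero {e : Expr} {P : Program} {m : Memory} :
      e.val m = 0 → Exec (.loop e P) m (e.cost + 1) m

/-- The memory that holds the word `w`: its length in cell `0`, its letters in the cells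
`1, …, w.length`, and `0` everywhere else. -/
def load (w : List ℕ) : Memory
  | 0 => w.length
  | i + 1 => w.getD i 0

/-- Started on the input word `w`, the program `P` halts after at most `T` steps with the word `v`
as its output.  (Cells behind the output word may contain anything.) -/
def OutputsWithin (P : Program) (w v : List ℕ) (T : ℕ) : Prop :=
  ∃ (t : ℕ) (m : Memory), t ≤ T ∧ Exec P (load w) t m ∧ ∀ i ≤ v.length, m i = load v i

/-- The size of a word of natural numbers: the total length of the binary representations of its
letters, plus one separator for each letter. -/
def wordSize (w : List ℕ) : ℕ := (w.map fun a => Nat.size a + 1).sum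

/-! ## Graph classes -/

/-- A class of finite graphs; vertex sets are of the form `{0, …, n - 1}`. The class need not be
closed under isomorphism. -/
abbrev GraphClass : Type := ∀ n : ℕ, Set (SimpleGraph (Fin n))

/-- There is a number `d` such that no graph of the class contains `K_{d,d}` as a (not necessarily
induced) subgraph. -/
def GraphClass.BicliqueFree (𝒞 : GraphClass) : Prop :=
  ∃ d : ℕ, ∀ (n : ℕ), ∀ G ∈ 𝒞 n, (completeBipartiteGraph (Fin d) (Fin d)).Free G

/-- The class of all graphs that are isomorphic to an induced subgraph of a member of `𝒞`. -/
def GraphClass.hereditaryClosure (𝒞 : GraphClass) : GraphClass :=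
  fun _ => {H | ∃ n : ℕ, ∃ G ∈ 𝒞 n, H.IsIndContained G}

/-! ## Dominating Set Discovery in the token sliding model -/

/-- Every vertex lies in `D` or has a neighbour in `D`. -/
def IsDominatingSet {n : ℕ} (G : SimpleGraph (Fin n)) (D : Finset (Fin n)) : Prop :=
  ∀ v, v ∈ D ∨ ∃ u ∈ D, G.Adj u v

/-- `C ⊢ C'`: one token of the configuration `C` slides along an edge to an unoccupied vertex. -/
def Slide {n : ℕ} (G : SimpleGraph (Fin n)) (C C' : Finset (Fin n)) : Prop :=
  ∃ y ∈ C, ∃ x, x ∉ C ∧ G.Adj x y ∧ C' = insert x (C.erase y)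

/-- An instance `(G, S, b)` of Dominating Set Discovery. -/
structure Instance : Type where
  /-- the number of vertices -/
  n : ℕ
  G : SimpleGraph (Fin n)
  /-- the initial configuration -/
  S : Finset (Fin n)
  /-- the budget -/
  b : ℕ

/-- The parameter `k`: the number of tokens. -/
def Instance.tokens (I : Instance) : ℕ := I.S.card

/-- `I` is a yes-instance: some discovery sequence `C 0 ⊢ C 1 ⊢ ⋯ ⊢ C ℓ` with `ℓ ≤ b` starts in
`S` and ends in a dominating set. -/
def Instance.IsYes (I : Instance) : Prop :=
  ∃ (l : ℕ) (C : ℕ → Finset (Fin I.n)), l ≤ I.b ∧ C 0 = I.S ∧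
    (∀ i < l, Slide I.G (C i) (C (i + 1))) ∧ IsDominatingSet I.G (C l)

open Classical in
/-- The encoding of an instance as a word: the number of vertices, the budget, the adjacency matrix
row by row, and the characteristic vector of the initial configuration. -/
noncomputable def Instance.encode (I : Instance) : List ℕ :=
  I.n :: I.b ::
    (((List.finRange I.n).flatMap fun u =>
        (List.finRange I.n).map fun v => if I.G.Adj u v then 1 else 0) ++
      (List.finRange I.n).map fun v => if v ∈ I.S then 1 else 0)

/-- The size of an instance. -/
noncomputable def Instance.size (I : Instance) : ℕ := wordSize I.encode

/-- Dominating Set Discovery, parameterized by the number `k` of tokens, has a polynomial kernel on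
`𝒞`: some program `P` computes, for every instance `I` whose graph lies in `𝒞`, in time polynomial
in the size of `I`, an equivalent instance `f I` whose size and parameter are bounded by a
polynomial in the parameter of `I`, and whose graph is again one of `𝒞` or an induced subgraph of
such a graph. -/
def HasPolynomialKernelOn (𝒞 : GraphClass) : Prop :=
  ∃ (P : Program) (f : Instance → Instance) (p q : Polynomial ℕ),
    ∀ I : Instance, I.G ∈ 𝒞 I.n →
      OutputsWithin P I.encode (f I).encode (p.eval I.size) ∧
      ((f I).IsYes ↔ I.IsYes) ∧
      (f I).size ≤ q.eval I.tokens ∧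
      (f I).tokens ≤ q.eval I.tokens ∧
      (f I).G ∈ 𝒞.hereditaryClosure (f I).n

end DSDiscovery

/-! Let k be the number of tokens and K_{d,d} the excluded biclique. Two facts shrink the graph.
First, there is a domination core: a set C, of size polynomial in k, such that any k vertices
dominating C dominate the whole graph (`IsCore.card_le`, `IsCore.dominates`). If very many vertices
of C have all of X among their closed neighbours, then k vertices that dominate them must meet X;
otherwise one of them, added to X, would still have too many common neighbours in C.
Biclique-freeness stops this at |X| = d. A further vertex with X in its closed neighbourhood is then
dominated automatically and need not enter C. Second, for a token only the closed neighbours in C of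
its target matter, and biclique-freeness leaves polynomially many such types
(`card_image_nbType_le`).

Sliding is a matter of distances. A sequence of slides yields walks from distinct tokens to the
final positions, and conversely walks from distinct tokens can be realized within their total
length, since colliding tokens may exchange roles (`Slides.exists_walks`, `exists_slides_of_walks`).
So every target may be replaced by the vertex of the same type closest to its token. In a
yes-instance finite distances are at most 3k (`HasWalk.exists_le_of_isDominatingSet`). Hence the
core, the tokens, and one shortest path per token and type within this radius induce an equivalent
instance, with the budget cut down to 3k² (`KernelData.isYes_iff`, `KernelData.card_le`).

For the running time, the algorithm is written in a small language of terms and bounded loops, each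
of whose commands compiles to a program with polynomial running time (`Term.runs_compile`,
`Cmd.runs_compile`). All sets above are tables filled in lexicographic order, where an entry is a
formula in earlier entries (`run_fill`). The last table spells out the encoded kernel
(`Instance.finalTables_out`). -/

namespace DSDiscovery

/-! ## Total correctness with time bounds -/

/-- Started on `m`, the program `P` halts within `T` steps in a memory satisfying `Q`. -/
def Runs (P : Program) (m : Memory) (T : ℕ) (Q : Memory → Prop) : Prop :=
  ∃ t m', t ≤ T ∧ Exec P m t m' ∧ Q m'

theorem Runs.mono {P : Program} {m : Memory} {S T : ℕ} {Q R : Memory → Prop}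
    (h : Runs P m S Q) (hST : S ≤ T) (hQR : ∀ m', Q m' → R m') : Runs P m T R := by
  obtain ⟨t, m', ht, he, hq⟩ := h
  exact ⟨t, m', ht.trans hST, he, hQR _ hq⟩

theorem Runs.seq {P P' : Program} {m : Memory} {S T : ℕ} {Q R : Memory → Prop}
    (h : Runs P m S Q) (h' : ∀ m', Q m' → Runs P' m' T R) :
    Runs (.seq P P') m (S + T) R := by
  obtain ⟨s, m₁, hs, he, hq⟩ := h
  obtain ⟨t, m₂, ht, he', hr⟩ := h' m₁ hq
  exact ⟨s + t, m₂, by omega, .seq he he', hr⟩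

theorem Runs.write {a e : Expr} {m : Memory} {T : ℕ} {Q : Memory → Prop}
    (hT : a.cost + e.cost + 1 ≤ T) (h : Q (Function.update m (a.val m) (e.val m))) :
    Runs (.write a e) m T Q :=
  ⟨_, _, hT, .write a e m, h⟩

theorem Runs.cond {e : Expr} {P P' : Program} {m : Memory} {T : ℕ} {Q : Memory → Prop}
    (h : e.val m ≠ 0 → Runs P m T Q) (h' : e.val m = 0 → Runs P' m T Q) :
    Runs (.cond e P P') m (e.cost + 1 + T) Q := by
  by_cases he : e.val m = 0
  · obtain ⟨t, m₁, ht, hx, hq⟩ := h' he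
    exact ⟨_, m₁, by omega, .cond_zero he hx, hq⟩
  · obtain ⟨t, m₁, ht, hx, hq⟩ := h he
    exact ⟨_, m₁, by omega, .cond_pos he hx, hq⟩

theorem Runs.loop {e : Expr} {P : Program} {m : Memory} {T : ℕ} (M : ℕ)
    (Inv : ℕ → Memory → Prop)
    (hpos : ∀ i < M, ∀ m, Inv i m → e.val m ≠ 0 ∧ Runs P m T (Inv (i + 1)))
    (hzero : ∀ m, Inv M m → e.val m = 0) (h0 : Inv 0 m) :
    Runs (.loop e P) m (M * (e.cost + 1 + T) + (e.cost + 1)) (Inv M) := by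
  suffices h : ∀ r i, i + r = M → ∀ m, Inv i m →
      Runs (.loop e P) m (r * (e.cost + 1 + T) + (e.cost + 1)) (Inv M) from
    h M 0 (by omega) m h0
  intro r
  induction r with
  | zero =>
    intro i hi m hm
    obtain rfl : i = M := by omega
    exact ⟨_, m, by omega, .loop_zero (hzero m hm), hm⟩
  | succ r ih =>
    intro i hi m hm
    obtain ⟨hne, s, m₁, hs, hx, hq⟩ := hpos i (by omega) m hm
    obtain ⟨t, m₂, ht, hx', hq'⟩ := ih (i + 1) (by omega) m₁ hq
    refine ⟨_, m₂, ?_, .loop_pos hne hx hx', hq'⟩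
    rw [Nat.succ_mul]
    omega

/-! ## A language of total functions with static polynomial running times -/

/-- The state of the tables. -/
abbrev Tables : Type := Fin 8 → ℕ → ℕ

/-- Terms over an input word `w`; with `N = w.length + 1`, summation ranges over `{0, …, N - 1}`
and the first factor of a product is capped at `N`. -/
inductive Term : Type
  | lit (c : ℕ) : Term
  | var (x : ℕ) : Term
  | inp (e : Term) : Term
  | tab (a : Fin 8) (e : Term) : Term
  | add (e₁ e₂ : Term) : Term
  | sub (e₁ e₂ : Term) : Term
  | mul (e₁ e₂ : Term) : Term
  | ite (c e₁ e₂ : Term) : Term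
  | sum (x : ℕ) (e : Term) : Term

/-- The value of a term. -/
def Term.eval (w : List ℕ) (τ : Tables) : Term → (ℕ → ℕ) → ℕ
  | .lit c, _ => c
  | .var x, ρ => ρ x
  | .inp e, ρ => load w (e.eval w τ ρ)
  | .tab a e, ρ => τ a (e.eval w τ ρ)
  | .add e₁ e₂, ρ => e₁.eval w τ ρ + e₂.eval w τ ρ
  | .sub e₁ e₂, ρ => e₁.eval w τ ρ - e₂.eval w τ ρ
  | .mul e₁ e₂, ρ => min (e₁.eval w τ ρ) (w.length + 1) * e₂.eval w τ ρ
  | .ite c e₁ e₂, ρ => if c.eval w τ ρ ≠ 0 then e₁.eval w τ ρ else e₂.eval w τ ρ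
  | .sum x e, ρ => ∑ i ∈ Finset.range (w.length + 1), e.eval w τ (Function.update ρ x i)

/-- Commands on tables. -/
inductive Cmd : Type
  | store (a : Fin 8) (i e : Term) : Cmd
  | seq (c₁ c₂ : Cmd) : Cmd
  | forN (x : ℕ) (c : Cmd) : Cmd

/-- The effect of a command. -/
def Cmd.run (w : List ℕ) : Cmd → (ℕ → ℕ) → Tables → Tables
  | .store a i e, ρ, τ =>
      Function.update τ a (Function.update (τ a) (i.eval w τ ρ) (e.eval w τ ρ))
  | .seq c₁ c₂, ρ, τ => c₂.run w ρ (c₁.run w ρ τ)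
  | .forN x c, ρ, τ =>
      (List.range (w.length + 1)).foldl (fun τ i => c.run w (Function.update ρ x i) τ) τ

/-! ### Memory layout -/

/-- The address of cell `i` of channel `c`, behind an input of length `L`. -/
def addr (L c i : ℕ) : ℕ := L + (c + 1) + 16 * i

theorem addr_inj {L c c' i i' : ℕ} (hc : c < 16) (hc' : c' < 16) :
    addr L c i = addr L c' i' ↔ c = c' ∧ i = i' := by
  unfold addr; omega

theorem lt_addr (L c i : ℕ) : L < addr L c i := by unfold addr; omega

/-- `2 * e` -/
def Expr.dbl (e : Expr) : Expr := e.add e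

/-- The expression for the address of a cell. -/
def slot (c : ℕ) (i : Expr) : Expr :=
  .add (.add (.read (.lit 0)) (.lit (c + 1))) i.dbl.dbl.dbl.dbl

theorem val_slot (m : Memory) (c : ℕ) (i : Expr) : (slot c i).val m = addr (m 0) c (i.val m) := by
  simp only [slot, Expr.val, Expr.dbl, addr]; omega

theorem cost_slot (c : ℕ) (i : Expr) : (slot c i).cost = 16 * i.cost + 20 := by
  simp only [slot, Expr.cost, Expr.dbl]; omega

/-- The memory `m` holds the input `w`, the values `ρ` of the variables, and the tables `τ`. -/
structure Holds (w : List ℕ) (ρ : ℕ → ℕ) (τ : Tables) (m : Memory) : Prop where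
  inp : ∀ i ≤ w.length, m i = load w i
  var : ∀ x, m (addr w.length 0 x) = ρ x
  tab : ∀ a i, m (addr w.length (a.val + 2) i) = τ a i

section
variable {w : List ℕ} {ρ : ℕ → ℕ} {τ : Tables} {m : Memory}

theorem Holds.zero (h : Holds w ρ τ m) : m 0 = w.length := h.inp 0 (Nat.zero_le _)

theorem Holds.setTmp (h : Holds w ρ τ m) (i v : ℕ) :
    Holds w ρ τ (Function.update m (addr w.length 1 i) v) where
  inp j hj := by
    rw [Function.update_of_ne (by have := lt_addr w.length 1 i; omega), h.inp j hj]
  var x := by rw [Function.update_of_ne (by rw [Ne, addr_inj] <;> omega), h.var]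
  tab a j := by
    have := a.isLt
    rw [Function.update_of_ne (by rw [Ne, addr_inj] <;> omega), h.tab]

theorem Holds.setVar (h : Holds w ρ τ m) (x v : ℕ) :
    Holds w (Function.update ρ x v) τ (Function.update m (addr w.length 0 x) v) where
  inp j hj := by
    rw [Function.update_of_ne (by have := lt_addr w.length 0 x; omega), h.inp j hj]
  var y := by
    by_cases hy : y = x
    · subst hy; simp
    · rw [Function.update_of_ne (by rw [Ne, addr_inj] <;> omega), Function.update_of_ne hy, h.var]
  tab a j := by
    have := a.isLt
    rw [Function.update_of_ne (by rw [Ne, addr_inj] <;> omega), h.tab]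

theorem Holds.setTab (h : Holds w ρ τ m) (a : Fin 8) (i v : ℕ) :
    Holds w ρ (Function.update τ a (Function.update (τ a) i v))
      (Function.update m (addr w.length (a.val + 2) i) v) where
  inp j hj := by
    rw [Function.update_of_ne (by have := lt_addr w.length (a.val + 2) i; omega), h.inp j hj]
  var y := by
    have := a.isLt
    rw [Function.update_of_ne (by rw [Ne, addr_inj] <;> omega), h.var]
  tab a' j := by
    have := a.isLt
    have := a'.isLt
    by_cases ha : a' = a
    · subst ha
      by_cases hj : j = i
      · subst hj; simp
      · rw [Function.update_of_ne (by rw [Ne, addr_inj] <;> omega), Function.update_self,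
          Function.update_of_ne hj, h.tab]
    · have : a'.val ≠ a.val := fun h => ha (Fin.ext h)
      rw [Function.update_of_ne (by rw [Ne, addr_inj] <;> omega), Function.update_of_ne ha, h.tab]

end

/-- The expression reading cell `h` of the stack of temporary values. -/
def tmp (h : ℕ) : Expr := .read (slot 1 (.lit h))

/-- Write `e` into cell `h` of the stack of temporary values. -/
def setTmp (h : ℕ) (e : Expr) : Program := .write (slot 1 (.lit h)) e

/-- The expression reading the variable `x`. -/
def rvar (x : ℕ) : Expr := .read (slot 0 (.lit x))

/-- Write `e` into the variable `x`. -/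
def setVar (x : ℕ) (e : Expr) : Program := .write (slot 0 (.lit x)) e

/-- The expression for `w.length + 1`. -/
def boundE : Expr := .add (.read (.lit 0)) (.lit 1)

theorem cost_tmp (h : ℕ) : (tmp h).cost = 37 := rfl
theorem cost_rvar (h : ℕ) : (rvar h).cost = 37 := rfl
theorem cost_boundE : boundE.cost = 4 := rfl

/-- Run `P` with the variable `x` set to `0, …, N - 1`, saving `x` in cell `h` of the stack. -/
def forLoop (x h : ℕ) (P : Program) : Program :=
  .seq (setTmp h (rvar x)) (.seq (setVar x (.lit 0))
    (.seq (.loop (.sub boundE (rvar x)) (.seq P (setVar x (.add (rvar x) (.lit 1)))))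
      (setVar x (tmp h))))

/-- The program evaluating a term, with the stack of temporary values used from cell `h` on. -/
def Term.compile : Term → ℕ → Program
  | .lit c, h => setTmp h (.lit c)
  | .var x, h => setTmp h (rvar x)
  | .inp e, h => .seq (e.compile h)
      -- Addresses behind the input hold working data, whereas `load` is 0 there; a nonzero
      -- difference detects them.
      (.cond (.sub (tmp h) (.read (.lit 0))) (setTmp h (.lit 0)) (setTmp h (.read (tmp h))))
  | .tab a e, h => .seq (e.compile h) (setTmp h (.read (slot (a.val + 2) (tmp h))))
  | .add e₁ e₂, h => .seq (e₁.compile h) (.seq (e₂.compile (h + 1))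
      (setTmp h (.add (tmp h) (tmp (h + 1)))))
  | .sub e₁ e₂, h => .seq (e₁.compile h) (.seq (e₂.compile (h + 1))
      (setTmp h (.sub (tmp h) (tmp (h + 1)))))
  | .mul e₁ e₂, h => .seq (e₁.compile (h + 1)) (.seq (e₂.compile (h + 2))
      -- Multiplication is repeated addition; capping the first factor bounds the number of
      -- iterations by N.
      (.seq (.cond (.sub (tmp (h + 1)) boundE) (setTmp (h + 1) boundE) .skip)
      (.seq (setTmp h (.lit 0))
        (.loop (tmp (h + 1)) (.seq (setTmp h (.add (tmp h) (tmp (h + 2))))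
          (setTmp (h + 1) (.sub (tmp (h + 1)) (.lit 1))))))))
  | .ite c e₁ e₂, h => .seq (c.compile h) (.cond (tmp h) (e₁.compile h) (e₂.compile h))
  | .sum x e, h => .seq (setTmp h (.lit 0))
      (forLoop x (h + 1) (.seq (e.compile (h + 2)) (setTmp h (.add (tmp h) (tmp (h + 2))))))

/-- The program executing a command. -/
def Cmd.compile : Cmd → ℕ → Program
  | .store a i e, h => .seq (i.compile h) (.seq (e.compile (h + 1))
      (.write (slot (a.val + 2) (tmp h)) (tmp (h + 1))))
  | .seq c₁ c₂, h => .seq (c₁.compile h) (c₂.compile h)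
  | .forN x c, h => forLoop x h (c.compile (h + 1))

/-! ### Correctness and running time of compiled terms and commands -/

section
variable {w : List ℕ} {ρ : ℕ → ℕ} {τ : Tables} {m : Memory}

theorem Holds.val_tmp (hm : Holds w ρ τ m) (h : ℕ) : (tmp h).val m = m (addr w.length 1 h) := by
  simp [tmp, Expr.val, val_slot, hm.zero]

theorem Holds.val_rvar (hm : Holds w ρ τ m) (x : ℕ) : (rvar x).val m = ρ x := by
  simp [rvar, Expr.val, val_slot, hm.zero, hm.var]

theorem Holds.val_boundE (hm : Holds w ρ τ m) : boundE.val m = w.length + 1 := by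
  simp [boundE, Expr.val, hm.zero]

/-- `m'` agrees with `m` on the first `h` cells of the stack of temporary values. -/
def SameTmp (L h : ℕ) (m m' : Memory) : Prop := ∀ i < h, m' (addr L 1 i) = m (addr L 1 i)

theorem SameTmp.refl (L h : ℕ) (m : Memory) : SameTmp L h m m := fun _ _ => rfl

theorem SameTmp.trans {L h h' : ℕ} {m m' m'' : Memory} (h₁ : SameTmp L h m m')
    (h₂ : SameTmp L h' m' m'') (hh : h ≤ h') : SameTmp L h m m'' :=
  fun i hi => (h₂ i (by omega)).trans (h₁ i hi)

theorem SameTmp.mono {L h h' : ℕ} {m m' : Memory} (h₁ : SameTmp L h' m m') (hh : h ≤ h') :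
    SameTmp L h m m' := fun i hi => h₁ i (by omega)

theorem sameTmp_update_tmp {L h j v : ℕ} (m : Memory) (hj : h ≤ j) :
    SameTmp L h m (Function.update m (addr L 1 j) v) := fun i hi => by
  rw [Function.update_of_ne (by rw [Ne, addr_inj] <;> omega)]

theorem update_tmp_of_ne {L i j v c : ℕ} (m : Memory) (hc : c < 16) (hj : c ≠ 1 ∨ i ≠ j) :
    (Function.update m (addr L 1 j) v) (addr L c i) = m (addr L c i) := by
  rw [Function.update_of_ne (by rw [Ne, addr_inj] <;> omega)]

theorem update_chan_of_ne {L i j v c c' : ℕ} (m : Memory) (hc : c < 16) (hc' : c' < 16)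
    (hj : c ≠ c') : (Function.update m (addr L c' j) v) (addr L c i) = m (addr L c i) := by
  rw [Function.update_of_ne (by rw [Ne, addr_inj] <;> omega)]

theorem sameTmp_update_of_ne {L h j v c : ℕ} (m : Memory) (hc : c < 16) (hc1 : c ≠ 1) :
    SameTmp L h m (Function.update m (addr L c j) v) := fun i _ => by
  rw [Function.update_of_ne (by rw [Ne, addr_inj] <;> omega)]

theorem runs_setTmp (hm : Holds w ρ τ m) {h T : ℕ} {e : Expr} {Q : Memory → Prop}
    (hT : e.cost + 40 ≤ T) (hQ : Q (Function.update m (addr w.length 1 h) (e.val m))) :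
    Runs (setTmp h e) m T Q := by
  refine Runs.write (by rw [cost_slot]; simp only [Expr.cost]; omega) ?_
  rw [val_slot, hm.zero]
  exact hQ

theorem runs_setVar (hm : Holds w ρ τ m) {x T : ℕ} {e : Expr} {Q : Memory → Prop}
    (hT : e.cost + 40 ≤ T) (hQ : Q (Function.update m (addr w.length 0 x) (e.val m))) :
    Runs (setVar x e) m T Q := by
  refine Runs.write (by rw [cost_slot]; simp only [Expr.cost]; omega) ?_
  rw [val_slot, hm.zero]
  exact hQ

/-- `σ i` are the tables after `i` rounds, and `J` is a further invariant that only depends on stack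
cells below `h`. The second height `h'` leaves room between `h'` and `h` for an accumulator that the
body may change, as summation needs, while the saved variable in cell `h` stays intact. -/
theorem runs_forLoop (hm : Holds w ρ τ m) {x h h' T : ℕ} {P : Program} (hh : h' ≤ h)
    (σ : ℕ → Tables) (J : ℕ → Memory → Prop) (h0 : σ 0 = τ) (hJ0 : J 0 m)
    (hJ : ∀ i m' m'', SameTmp w.length h m' m'' → J i m' → J i m'')
    (hP : ∀ i ≤ w.length, ∀ m', Holds w (Function.update ρ x i) (σ i) m' → J i m' →
      Runs P m' T fun m'' => Holds w (Function.update ρ x i) (σ (i + 1)) m'' ∧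
        J (i + 1) m'' ∧ SameTmp w.length h' m' m'' ∧
        m'' (addr w.length 1 h) = m' (addr w.length 1 h)) :
    Runs (forLoop x h P) m ((w.length + 1) * (T + 200) + 400) fun m' =>
      Holds w ρ (σ (w.length + 1)) m' ∧ J (w.length + 1) m' ∧ SameTmp w.length h' m m' := by
  subst h0
  let Inv : ℕ → Memory → Prop := fun i m' =>
    Holds w (Function.update ρ x i) (σ i) m' ∧ J i m' ∧ SameTmp w.length h' m m' ∧
      m' (addr w.length 1 h) = ρ x
  have hloop : ∀ m', Inv 0 m' → Runs (.loop (.sub boundE (rvar x))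
      (.seq P (setVar x (.add (rvar x) (.lit 1))))) m'
      ((w.length + 1) * (42 + 1 + (T + 80)) + (42 + 1)) (Inv (w.length + 1)) := by
    intro m' hm'
    refine Runs.loop (w.length + 1) Inv ?_ ?_ hm'
    · rintro i hi m₁ ⟨h₁, h₂, h₃, h₄⟩
      refine ⟨?_, (hP i (by omega) m₁ h₁ h₂).seq ?_⟩
      · simp only [Expr.val, h₁.val_boundE, h₁.val_rvar, Function.update_self]; omega
      · rintro m₂ ⟨k₁, k₂, k₃, k₄⟩
        have hv : (Expr.add (rvar x) (.lit 1)).val m₂ = i + 1 := by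
          simp [Expr.val, k₁.val_rvar]
        refine runs_setVar k₁ (by simp [Expr.cost, cost_rvar]) ?_
        rw [hv]
        refine ⟨?_, hJ _ _ _ (sameTmp_update_of_ne _ (by omega) (by omega)) k₂, ?_, ?_⟩
        · have := k₁.setVar x (i + 1)
          rwa [Function.update_idem] at this
        · exact h₃.trans (k₃.trans (sameTmp_update_of_ne _ (by omega) (by omega)) le_rfl) le_rfl
        · rw [update_chan_of_ne _ (by omega) (by omega) (by omega), k₄, h₄]
    · rintro m₁ ⟨h₁, -, -, -⟩
      simp [Expr.val, h₁.val_boundE, h₁.val_rvar]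
  have hm₁ := hm.setTmp h (ρ x)
  have hfin : Runs (forLoop x h P) m (77 + (41 + (((w.length + 1) * (42 + 1 + (T + 80)) +
      (42 + 1)) + 77))) fun m' =>
      Holds w ρ (σ (w.length + 1)) m' ∧ J (w.length + 1) m' ∧ SameTmp w.length h' m m' := by
    refine Runs.seq (Q := fun m' => m' = Function.update m (addr w.length 1 h) (ρ x)) ?_ ?_
    · exact runs_setTmp hm (by simp [cost_rvar]) (by rw [hm.val_rvar])
    rintro m' rfl
    refine Runs.seq (Q := Inv 0) ?_ ?_
    · refine runs_setVar hm₁ (by simp [Expr.cost]) ⟨hm₁.setVar x 0, ?_, ?_, ?_⟩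
      · refine hJ 0 m _ ?_ hJ0
        exact (sameTmp_update_tmp m le_rfl).trans
          (sameTmp_update_of_ne _ (by omega) (by omega)) le_rfl
      · exact (sameTmp_update_tmp m hh).trans
          (sameTmp_update_of_ne _ (by omega) (by omega)) le_rfl
      · rw [update_chan_of_ne _ (by omega) (by omega) (by omega), Function.update_self]
    intro m' hm'
    refine (hloop m' hm').seq ?_
    rintro m₁ ⟨h₁, h₂, h₃, h₄⟩
    refine runs_setVar h₁ (by simp [cost_tmp]) ?_
    rw [h₁.val_tmp, h₄]
    refine ⟨?_, hJ _ _ _ (sameTmp_update_of_ne _ (by omega) (by omega)) h₂,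
      h₃.trans (sameTmp_update_of_ne _ (by omega) (by omega)) le_rfl⟩
    have := h₁.setVar x (ρ x)
    rwa [Function.update_idem, Function.update_eq_self] at this
  refine hfin.mono ?_ fun _ h => h
  have : (w.length + 1) * (42 + 1 + (T + 80)) ≤ (w.length + 1) * (T + 200) :=
    Nat.mul_le_mul_left _ (by omega)
  omega

/-- The postcondition of the evaluation of a term to the value `v`. -/
structure Evaluated (w : List ℕ) (ρ : ℕ → ℕ) (τ : Tables) (h v : ℕ) (m m' : Memory) : Prop where
  holds : Holds w ρ τ m'
  same : SameTmp w.length h m m'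
  val : m' (addr w.length 1 h) = v

theorem Evaluated.setTmp {h v v' : ℕ} {m' : Memory} (h' : Evaluated w ρ τ h v m m') :
    Evaluated w ρ τ h v' m (Function.update m' (addr w.length 1 h) v') :=
  ⟨h'.holds.setTmp _ _, h'.same.trans (sameTmp_update_tmp _ le_rfl) le_rfl, by simp⟩

theorem evaluated_setTmp (hm : Holds w ρ τ m) (h v : ℕ) :
    Evaluated w ρ τ h v m (Function.update m (addr w.length 1 h) v) :=
  ⟨hm.setTmp _ _, sameTmp_update_tmp _ le_rfl, by simp⟩

end

open Polynomial in
theorem Term.runs_compile (t : Term) : ∃ p : ℕ[X], ∀ (w : List ℕ) (ρ : ℕ → ℕ) (τ : Tables)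
    (m : Memory) (h : ℕ), Holds w ρ τ m →
      Runs (t.compile h) m (p.eval (w.length + 1)) (Evaluated w ρ τ h (t.eval w τ ρ) m) := by
  -- Addition and subtraction compile alike, so they are handled together.
  have binop : ∀ (f : Expr → Expr → Expr) (g : ℕ → ℕ → ℕ) (e₁ e₂ : Term) (p₁ p₂ : ℕ[X]),
      (∀ a b m, (f a b).val m = g (a.val m) (b.val m)) →
      (∀ a b, (f a b).cost = a.cost + b.cost + 1) →
      (∀ (w : List ℕ) (ρ : ℕ → ℕ) (τ : Tables) (m : Memory) (h : ℕ), Holds w ρ τ m →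
      Runs (e₁.compile h) m (p₁.eval (w.length + 1)) (Evaluated w ρ τ h (e₁.eval w τ ρ) m)) →
      (∀ (w : List ℕ) (ρ : ℕ → ℕ) (τ : Tables) (m : Memory) (h : ℕ), Holds w ρ τ m →
      Runs (e₂.compile h) m (p₂.eval (w.length + 1)) (Evaluated w ρ τ h (e₂.eval w τ ρ) m)) →
      ∃ p : ℕ[X], ∀ (w : List ℕ) (ρ : ℕ → ℕ) (τ : Tables)
    (m : Memory) (h : ℕ), Holds w ρ τ m →
      Runs (.seq (e₁.compile h) (.seq (e₂.compile (h + 1)) (DSDiscovery.setTmp h (f (tmp h) (tmp (h + 1)))))) m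
        (p.eval (w.length + 1)) (Evaluated w ρ τ h (g (e₁.eval w τ ρ) (e₂.eval w τ ρ)) m) := by
    intro f g e₁ e₂ p₁ p₂ hf hc h₁ h₂
    refine ⟨p₁ + (p₂ + 115), fun w ρ τ m h hm => ?_⟩
    simp only [eval_add, eval_ofNat]
    refine (h₁ w ρ τ m h hm).seq fun m₁ k₁ => (h₂ w ρ τ m₁ (h + 1) k₁.holds).seq fun m₂ k₂ => ?_
    refine runs_setTmp k₂.holds (by simp [hc, cost_tmp]) ?_
    rw [hf, k₂.holds.val_tmp, k₂.holds.val_tmp, k₂.val, k₂.same h (by omega), k₁.val]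
    exact ⟨k₂.holds.setTmp _ _, k₁.same.trans ((k₂.same.mono (by omega)).trans
      (sameTmp_update_tmp _ le_rfl) le_rfl) le_rfl, by simp⟩
  induction t with
  | lit c =>
    refine ⟨100, fun w ρ τ m h hm => ?_⟩
    simp only [eval_ofNat]
    exact runs_setTmp hm (by simp [Expr.cost]) (evaluated_setTmp hm h _)
  | var x =>
    refine ⟨100, fun w ρ τ m h hm => ?_⟩
    simp only [eval_ofNat]
    refine runs_setTmp hm (by simp [cost_rvar]) ?_
    rw [hm.val_rvar]
    exact evaluated_setTmp hm h _
  | inp e ih =>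
    obtain ⟨p, hp⟩ := ih
    refine ⟨p + 200, fun w ρ τ m h hm => ?_⟩
    simp only [eval_add, eval_ofNat]
    refine (hp w ρ τ m h hm).seq fun m₁ k₁ => ?_
    have hval : (Expr.sub (tmp h) (.read (.lit 0))).val m₁ = e.eval w τ ρ - w.length := by
      simp only [Expr.val, k₁.holds.val_tmp, k₁.val, k₁.holds.zero]
    refine Runs.mono (Runs.cond (T := 100) ?_ ?_) (by simp [Expr.cost, cost_tmp]) fun _ h => h
    · intro hne
      refine runs_setTmp k₁.holds (by simp [Expr.cost]) ?_
      have : load w (e.eval w τ ρ) = 0 := by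
        obtain ⟨j, hj⟩ : ∃ j, e.eval w τ ρ = j + 1 := ⟨e.eval w τ ρ - 1, by omega⟩
        rw [hj]
        exact List.getD_eq_default _ _ (by omega)
      simpa [Term.eval, this, Expr.val] using k₁.setTmp (v' := 0)
    · intro hz
      refine runs_setTmp k₁.holds (by simp [Expr.cost, cost_tmp]) ?_
      have : (Expr.read (tmp h)).val m₁ = load w (e.eval w τ ρ) := by
        simp only [Expr.val, k₁.holds.val_tmp, k₁.val]
        exact k₁.holds.inp _ (by omega)
      rw [this]
      exact k₁.setTmp
  | tab a e ih =>
    obtain ⟨p, hp⟩ := ih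
    refine ⟨p + C 1000, fun w ρ τ m h hm => ?_⟩
    simp only [eval_add, eval_C]
    refine (hp w ρ τ m h hm).seq fun m₁ k₁ => ?_
    refine runs_setTmp k₁.holds (by simp [Expr.cost, cost_tmp, cost_slot]) ?_
    simp only [Expr.val, val_slot, k₁.holds.val_tmp, k₁.val, k₁.holds.zero, k₁.holds.tab]
    exact k₁.setTmp
  | add e₁ e₂ ih₁ ih₂ =>
    obtain ⟨p₁, h₁⟩ := ih₁
    obtain ⟨p₂, h₂⟩ := ih₂
    exact binop .add (· + ·) e₁ e₂ p₁ p₂ (fun _ _ _ => rfl) (fun _ _ => rfl) h₁ h₂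
  | sub e₁ e₂ ih₁ ih₂ =>
    obtain ⟨p₁, h₁⟩ := ih₁
    obtain ⟨p₂, h₂⟩ := ih₂
    exact binop .sub (· - ·) e₁ e₂ p₁ p₂ (fun _ _ _ => rfl) (fun _ _ => rfl) h₁ h₂
  | mul e₁ e₂ ih₁ ih₂ =>
    obtain ⟨p₁, h₁⟩ := ih₁
    obtain ⟨p₂, h₂⟩ := ih₂
    refine ⟨p₁ + (p₂ + (200 + (100 + (X * (37 + 1 + 300) + (37 + 1))))), fun w ρ τ m h hm => ?_⟩
    simp only [eval_add, eval_ofNat, eval_mul, eval_X, eval_one]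
    refine (h₁ w ρ τ m (h + 1) hm).seq fun m₁ k₁ =>
      (h₂ w ρ τ m₁ (h + 2) k₁.holds).seq fun m₂ k₂ => ?_
    set a := e₁.eval w τ ρ with ha
    set b := e₂.eval w τ ρ with hb
    set c := min a (w.length + 1) with hc
    refine Runs.seq (Q := fun m' => Holds w ρ τ m' ∧ SameTmp w.length h m m' ∧
      m' (addr w.length 1 (h + 1)) = c ∧ m' (addr w.length 1 (h + 2)) = b) ?_ ?_
    · have hval : (Expr.sub (tmp (h + 1)) boundE).val m₂ = a - (w.length + 1) := by
        simp only [Expr.val, k₂.holds.val_tmp, k₂.holds.val_boundE, k₂.same (h + 1) (by omega),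
          k₁.val]
      refine Runs.mono (Runs.cond (T := 100) ?_ ?_)
        (by simp [Expr.cost, cost_tmp, cost_boundE]) fun _ h => h
      · intro hne
        refine runs_setTmp k₂.holds (by simp [cost_boundE]) ?_
        rw [k₂.holds.val_boundE]
        refine ⟨k₂.holds.setTmp _ _, ?_, ?_, ?_⟩
        · exact (k₁.same.mono (by omega)).trans ((k₂.same.mono (by omega)).trans
            (sameTmp_update_tmp _ (by omega)) le_rfl) le_rfl
        · rw [Function.update_self]; omega
        · rw [update_tmp_of_ne _ (by omega) (by omega), k₂.val]
      · intro hz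
        refine ⟨1, m₂, by omega, .skip m₂, k₂.holds, ?_, ?_, k₂.val⟩
        · exact (k₁.same.mono (by omega)).trans (k₂.same.mono (by omega)) le_rfl
        · rw [k₂.same (h + 1) (by omega), k₁.val]; omega
    rintro m₃ ⟨q₁, q₂, q₃, q₄⟩
    let Inv : ℕ → Memory → Prop := fun i m' => Holds w ρ τ m' ∧ SameTmp w.length h m m' ∧
      m' (addr w.length 1 h) = i * b ∧ m' (addr w.length 1 (h + 1)) = c - i ∧
      m' (addr w.length 1 (h + 2)) = b
    refine Runs.seq (Q := Inv 0) ?_ ?_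
    · refine runs_setTmp q₁ (by simp [Expr.cost]) ⟨q₁.setTmp _ _, ?_, ?_, ?_, ?_⟩
      · exact q₂.trans (sameTmp_update_tmp _ le_rfl) le_rfl
      · simp [Expr.val]
      · rw [update_tmp_of_ne _ (by omega) (by omega), q₃]; rfl
      · rw [update_tmp_of_ne _ (by omega) (by omega), q₄]
    intro m₄ hm₄
    refine Runs.mono (Runs.loop (T := 300) c Inv ?_ ?_ hm₄) ?_ ?_
    · rintro i hi m₅ ⟨r₁, r₂, r₃, r₄, r₅⟩
      refine ⟨by rw [r₁.val_tmp, r₄]; omega, ?_⟩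
      refine Runs.mono (S := 150 + 150) (Runs.seq (Q := fun m' =>
        m' = Function.update m₅ (addr w.length 1 h) ((i + 1) * b)) ?_ ?_) le_rfl fun _ h => h
      · refine runs_setTmp r₁ (by simp [Expr.cost, cost_tmp]) ?_
        simp only [Expr.val, r₁.val_tmp, r₃, r₅]
        rw [Nat.succ_mul]
      rintro m₆ rfl
      have hm₆ := r₁.setTmp h ((i + 1) * b)
      refine runs_setTmp hm₆ (by simp [Expr.cost, cost_tmp]) ⟨hm₆.setTmp _ _, ?_, ?_, ?_, ?_⟩
      · exact r₂.trans ((sameTmp_update_tmp _ le_rfl).trans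
          (sameTmp_update_tmp _ (by omega)) le_rfl) le_rfl
      · rw [update_tmp_of_ne _ (by omega) (by omega), Function.update_self]
      · simp only [Expr.val, hm₆.val_tmp, Function.update_self]
        rw [update_tmp_of_ne _ (by omega) (by omega), r₄]; omega
      · rw [update_tmp_of_ne _ (by omega) (by omega), update_tmp_of_ne _ (by omega) (by omega), r₅]
    · rintro m₅ ⟨r₁, r₂, r₃, r₄, r₅⟩
      rw [r₁.val_tmp, r₄]; omega
    · rw [cost_tmp]
      exact Nat.add_le_add_right (Nat.mul_le_mul_right _ (min_le_right _ _)) _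
    · rintro m₅ ⟨r₁, r₂, r₃, r₄, r₅⟩
      exact ⟨r₁, r₂, r₃⟩
  | ite c e₁ e₂ ihc ih₁ ih₂ =>
    obtain ⟨p, hp⟩ := ihc
    obtain ⟨p₁, h₁⟩ := ih₁
    obtain ⟨p₂, h₂⟩ := ih₂
    refine ⟨p + (37 + 1 + (p₁ + p₂)), fun w ρ τ m h hm => ?_⟩
    simp only [eval_add, eval_ofNat, eval_one]
    refine (hp w ρ τ m h hm).seq fun m₁ k₁ => ?_
    have hval : (tmp h).val m₁ = c.eval w τ ρ := by rw [k₁.holds.val_tmp, k₁.val]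
    refine Runs.cond ?_ ?_
    · intro hne
      rw [hval] at hne
      refine (h₁ w ρ τ m₁ h k₁.holds).mono (by omega) fun m₂ k₂ =>
        ⟨k₂.holds, k₁.same.trans k₂.same le_rfl, ?_⟩
      rw [k₂.val, Term.eval, if_pos hne]
    · intro hne
      rw [hval] at hne
      refine (h₂ w ρ τ m₁ h k₁.holds).mono (by omega) fun m₂ k₂ =>
        ⟨k₂.holds, k₁.same.trans k₂.same le_rfl, ?_⟩
      rw [k₂.val, Term.eval, if_neg (not_not.mpr hne)]
  | sum x e ih =>
    obtain ⟨p, hp⟩ := ih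
    refine ⟨41 + (X * ((p + 115) + 200) + 400), fun w ρ τ m h hm => ?_⟩
    simp only [eval_add, eval_ofNat, eval_mul, eval_X]
    refine Runs.seq (Q := fun m' => m' = Function.update m (addr w.length 1 h) 0) ?_ ?_
    · exact runs_setTmp hm (by simp [Expr.cost]) rfl
    rintro m₁ rfl
    have hm₁ := hm.setTmp h 0
    let J : ℕ → Memory → Prop := fun i m' =>
      m' (addr w.length 1 h) = ∑ j ∈ Finset.range i, e.eval w τ (Function.update ρ x j)
    refine Runs.mono (runs_forLoop (h' := h) (T := p.eval (w.length + 1) + 115) hm₁ (by omega)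
      (fun _ => τ) J rfl (by simp [J]) ?_ ?_) le_rfl ?_
    · intro i m' m'' hs hJ
      exact (hs h (by omega)).trans hJ
    · intro i hi m' hm' hJ
      refine (hp w _ τ m' (h + 2) hm').seq fun m₂ k₂ => ?_
      refine runs_setTmp k₂.holds (by simp [Expr.cost, cost_tmp]) ⟨k₂.holds.setTmp _ _, ?_, ?_, ?_⟩
      · simp only [J, Function.update_self, Expr.val, k₂.holds.val_tmp, k₂.val,
          k₂.same h (by omega), Finset.sum_range_succ]
        rw [hJ]
      · exact (k₂.same.mono (by omega)).trans (sameTmp_update_tmp _ le_rfl) le_rfl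
      · rw [update_tmp_of_ne _ (by omega) (by omega), k₂.same _ (by omega)]
    · rintro m' ⟨h₁, h₂, h₃⟩
      exact ⟨h₁, (sameTmp_update_tmp _ le_rfl).trans h₃ le_rfl, h₂⟩

open Polynomial in
theorem Cmd.runs_compile (c : Cmd) : ∃ p : ℕ[X], ∀ (w : List ℕ) (ρ : ℕ → ℕ) (τ : Tables)
    (m : Memory) (h : ℕ), Holds w ρ τ m →
      Runs (c.compile h) m (p.eval (w.length + 1)) fun m' =>
        Holds w ρ (c.run w ρ τ) m' ∧ SameTmp w.length h m m' := by
  induction c with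
  | store a i e =>
    obtain ⟨p₁, h₁⟩ := i.runs_compile
    obtain ⟨p₂, h₂⟩ := e.runs_compile
    refine ⟨p₁ + (p₂ + C 1000), fun w ρ τ m h hm => ?_⟩
    simp only [eval_add, eval_C]
    refine (h₁ w ρ τ m h hm).seq fun m₁ k₁ => (h₂ w ρ τ m₁ (h + 1) k₁.holds).seq fun m₂ k₂ => ?_
    refine Runs.write (by simp [cost_slot, cost_tmp]) ?_
    have ha := a.isLt
    simp only [val_slot, k₂.holds.val_tmp, k₂.holds.zero, k₂.val, k₂.same h (by omega), k₁.val]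
    exact ⟨k₂.holds.setTab _ _ _, k₁.same.trans ((k₂.same.mono (by omega)).trans
      (sameTmp_update_of_ne _ (by omega) (by omega)) le_rfl) le_rfl⟩
  | seq c₁ c₂ ih₁ ih₂ =>
    obtain ⟨p₁, h₁⟩ := ih₁
    obtain ⟨p₂, h₂⟩ := ih₂
    refine ⟨p₁ + p₂, fun w ρ τ m h hm => ?_⟩
    simp only [eval_add]
    refine (h₁ w ρ τ m h hm).seq fun m₁ k₁ => ?_
    exact (h₂ w ρ _ m₁ h k₁.1).mono le_rfl fun m₂ k₂ => ⟨k₂.1, k₁.2.trans k₂.2 le_rfl⟩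
  | forN x c ih =>
    obtain ⟨p, hp⟩ := ih
    refine ⟨X * (p + 200) + 400, fun w ρ τ m h hm => ?_⟩
    simp only [eval_add, eval_ofNat, eval_mul, eval_X]
    let σ : ℕ → Tables := fun i =>
      (List.range i).foldl (fun τ i => c.run w (Function.update ρ x i) τ) τ
    refine Runs.mono (runs_forLoop (h' := h) (T := p.eval (w.length + 1)) hm le_rfl σ
      (fun _ _ => True) rfl trivial (fun _ _ _ _ _ => trivial) ?_) le_rfl ?_
    · intro i hi m' hm' _
      refine (hp w _ _ m' (h + 1) hm').mono le_rfl fun m₂ k₂ => ⟨?_, trivial,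
        k₂.2.mono (by omega), k₂.2 h (by omega)⟩
      have : σ (i + 1) = c.run w (Function.update ρ x i) (σ i) := by
        simp [σ, List.range_succ]
      rw [this]
      exact k₂.1
    · rintro m' ⟨h₁, -, h₃⟩
      exact ⟨h₁, h₃⟩

/-- Write the cells `0, …, w.length` of table `a` to the output. -/
def copyOut (a : Fin 8) : Program :=
  .seq (setVar 0 (.lit 1)) (.seq
    (.loop (.sub boundE (rvar 0)) (.seq
      (.write (rvar 0) (.read (slot (a.val + 2) (rvar 0))))
      (setVar 0 (.add (rvar 0) (.lit 1)))))
    -- Cell 0 comes last: every table address is computed from the input length stored there.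
    (.write (.lit 0) (.read (slot (a.val + 2) (.lit 0)))))

theorem runs_copyOut (a : Fin 8) {w : List ℕ} {ρ : ℕ → ℕ} {τ : Tables} {m : Memory}
    (hm : Holds w ρ τ m) :
    Runs (copyOut a) m ((w.length + 1) * 2000 + 2000) fun m' => ∀ i ≤ w.length, m' i = τ a i := by
  have ha := a.isLt
  set L := w.length with hL
  let Inv : ℕ → Memory → Prop := fun i m' => m' 0 = L ∧ m' (addr L 0 0) = i + 1 ∧
    (∀ j, m' (addr L (a.val + 2) j) = τ a j) ∧ ∀ j, 1 ≤ j → j ≤ i → m' j = τ a j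
  have hr : ∀ m' : Memory, m' 0 = L → (rvar 0).val m' = m' (addr L 0 0) := fun m' h => by
    simp [rvar, Expr.val, val_slot, h]
  have main : Runs (copyOut a) m (41 + ((L * (42 + 1 + (1000 + 200)) + (42 + 1)) + 1000))
      fun m' => ∀ i ≤ L, m' i = τ a i := by
    refine Runs.seq (Q := Inv 0) ?_ ?_
    · refine runs_setVar hm (by simp [Expr.cost]) ⟨?_, by simp [Expr.val, hL], ?_, by omega⟩
      · rw [Function.update_of_ne (by have := lt_addr w.length 0 0; omega), hm.zero]
      · intro j
        rw [update_chan_of_ne _ (by omega) (by omega) (by omega), hm.tab]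
    intro m₁ hm₁
    refine Runs.seq (Runs.loop (T := 1000 + 200) L Inv ?_ ?_ hm₁) ?_
    · rintro i hi m₂ ⟨h₁, h₂, h₃, h₄⟩
      refine ⟨by simp only [Expr.val, hr m₂ h₁, h₂, boundE, h₁]; omega, ?_⟩
      -- The output overwrites only the input area, which lies below all variables and tables.
      have key : ∀ c j, i + 1 ≠ addr L c j := fun c j => by have := lt_addr L c j; omega
      refine Runs.seq (Q := fun m' => m' = Function.update m₂ (i + 1) (τ a (i + 1))) ?_ ?_
      · refine Runs.write (by simp [Expr.cost, cost_rvar, cost_slot]) ?_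
        simp only [Expr.val, hr m₂ h₁, h₂, val_slot, h₁, h₃]
      rintro m₃ rfl
      have h0 : (Function.update m₂ (i + 1) (τ a (i + 1))) 0 = L := by
        rw [Function.update_of_ne (by omega), h₁]
      have hv : (Function.update m₂ (i + 1) (τ a (i + 1))) (addr L 0 0) = i + 1 := by
        rw [Function.update_of_ne (key 0 0).symm, h₂]
      refine Runs.write (by simp [Expr.cost, cost_rvar, cost_slot]) ?_
      simp only [Expr.val, val_slot, hr _ h0, hv, h0]
      refine ⟨?_, by simp, ?_, ?_⟩
      · rw [Function.update_of_ne (by have := lt_addr L 0 0; omega), h0]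
      · intro j
        rw [update_chan_of_ne _ (by omega) (by omega) (by omega),
          Function.update_of_ne (key _ _).symm, h₃]
      · intro j hj hj'
        rw [Function.update_of_ne (by have := lt_addr L 0 0; omega)]
        by_cases hji : j = i + 1
        · subst hji; rw [Function.update_self]
        · rw [Function.update_of_ne hji, h₄ j hj (by omega)]
    · rintro m₂ ⟨h₁, h₂, h₃, h₄⟩
      simp only [Expr.val, hr m₂ h₁, h₂, boundE, h₁]; omega
    · rintro m₂ ⟨h₁, h₂, h₃, h₄⟩
      refine Runs.write (by simp [Expr.cost, cost_slot]) ?_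
      intro j hj
      simp only [Expr.val, val_slot, h₁, h₃]
      by_cases hj0 : j = 0
      · subst hj0; rw [Function.update_self]
      · rw [Function.update_of_ne hj0, h₄ j (by omega) hj]
  exact main.mono (by omega) fun _ h => h

theorem holds_load (w : List ℕ) : Holds w (fun _ => 0) (fun _ _ => 0) (load w) := by
  have h : ∀ c i, load w (addr w.length c i) = 0 := fun c i => by
    obtain ⟨j, hj⟩ : ∃ j, addr w.length c i = j + 1 := ⟨w.length + c + 16 * i, by unfold addr; omega⟩
    rw [hj]
    exact List.getD_eq_default _ _ (by have := lt_addr w.length c i; omega)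
  exact ⟨fun _ _ => rfl, fun _ => h _ _, fun _ _ => h _ _⟩

theorem length_le_wordSize (w : List ℕ) : w.length ≤ wordSize w := by
  induction w with
  | nil => simp
  | cons a w ih => simp only [wordSize, List.map_cons, List.sum_cons, List.length_cons] at *; omega

theorem polynomial_eval_mono (p : Polynomial ℕ) {a b : ℕ} (h : a ≤ b) : p.eval a ≤ p.eval b := by
  rw [Polynomial.eval_eq_sum, Polynomial.eval_eq_sum]
  exact Finset.sum_le_sum fun i _ => Nat.mul_le_mul_left _ (Nat.pow_le_pow_left h i)

open Polynomial in
/-- A command whose final table `a` starts with the word `v` yields a program with output `v`. -/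
theorem Cmd.exists_program (c : Cmd) (a : Fin 8) : ∃ (P : Program) (p : ℕ[X]),
    ∀ w v : List ℕ, v.length ≤ w.length →
      (∀ i ≤ v.length, c.run w (fun _ => 0) (fun _ _ => 0) a i = load v i) →
      OutputsWithin P w v (p.eval (wordSize w)) := by
  obtain ⟨p, hp⟩ := c.runs_compile
  refine ⟨.seq (c.compile 0) (copyOut a), (p + (X * C 2000 + C 2000)).comp (X + 1),
    fun w v hvw hv => ?_⟩
  obtain ⟨t, m', ht, hx, hq⟩ := (hp w _ _ _ 0 (holds_load w)).seq fun m₁ k₁ => runs_copyOut a k₁.1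
  refine ⟨t, m', ht.trans ?_, hx, fun i hi => by rw [hq i (by omega), hv i hi]⟩
  have := polynomial_eval_mono (p + (X * C 2000 + C 2000))
    (Nat.add_le_add_right (length_le_wordSize w) 1)
  simpa using this

/-! ## Filling tables -/

theorem foldl_range_mul {α : Type*} (M K : ℕ) (f : α → ℕ → α) (s : α) :
    (List.range (M * K)).foldl f s =
      (List.range M).foldl (fun s i => (List.range K).foldl (fun s j => f s (i * K + j)) s) s := by
  induction M with
  | zero => simp
  | succ M ih =>
    rw [Nat.succ_mul, List.range_add, List.foldl_append, ih, List.range_succ, List.foldl_append,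
      List.foldl_map]
    rfl

/-- Later writes go to later positions, so the state `σ` in which entry `q` is computed already
agrees with the final one on all earlier entries. This permits recursive definitions inside a single
table. -/
theorem foldl_store (a : Fin 8) (F : ℕ → Tables → ℕ) (τ : Tables) (M : ℕ) :
    let τ' := (List.range M).foldl
      (fun τ p => Function.update τ a (Function.update (τ a) p (F p τ))) τ
    (∀ a', a' ≠ a → τ' a' = τ a') ∧ ∀ q < M, ∃ σ : Tables, τ' a q = F q σ ∧
      (∀ a', a' ≠ a → σ a' = τ a') ∧ ∀ i < q, σ a i = τ' a i := by
  induction M with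
  | zero => simp
  | succ M ih =>
    simp only [List.range_succ, List.foldl_append, List.foldl_cons, List.foldl_nil] at ih ⊢
    set τ' := (List.range M).foldl
      (fun τ p => Function.update τ a (Function.update (τ a) p (F p τ))) τ
    refine ⟨fun a' ha' => by rw [Function.update_of_ne ha', ih.1 a' ha'], fun q hq => ?_⟩
    simp only [Function.update_self]
    rcases Nat.lt_succ_iff_lt_or_eq.mp hq with hq' | rfl
    · obtain ⟨σ, h₁, h₂, h₃⟩ := ih.2 q hq'
      refine ⟨σ, by rw [Function.update_of_ne (by omega), h₁], h₂, fun i hi => ?_⟩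
      rw [h₃ i hi, Function.update_of_ne (by omega)]
    · exact ⟨τ', by simp, ih.1, fun i hi => by rw [Function.update_of_ne (by omega)]⟩

/-- The position of the entry `(x, y, z)` of a table with side length `N`. -/
def ix (N x y z : ℕ) : ℕ := N * (N * x + y) + z

/-- The environment in which the first three variables have the values `x`, `y` and `z`. -/
def env3 (x y z : ℕ) : ℕ → ℕ
  | 0 => x
  | 1 => y
  | 2 => z
  | _ => 0

@[simp] theorem env3_zero (x y z : ℕ) : env3 x y z 0 = x := rfl
@[simp] theorem env3_one (x y z : ℕ) : env3 x y z 1 = y := rfl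
@[simp] theorem env3_two (x y z : ℕ) : env3 x y z 2 = z := rfl

theorem update_env3 (x y z : ℕ) :
    Function.update (Function.update (Function.update (fun _ => 0) 0 x) 1 y) 2 z = env3 x y z := by
  funext i
  match i with
  | 0 => rfl
  | 1 => rfl
  | 2 => rfl
  | i + 3 => rfl

/-- The term for `N`. -/
def boundT : Term := .add (.inp (.lit 0)) (.lit 1)

theorem eval_boundT (w : List ℕ) (τ : Tables) (ρ : ℕ → ℕ) :
    boundT.eval w τ ρ = w.length + 1 := rfl

/-- The term for the position of an entry of a table. -/
def ixT (e₁ e₂ e₃ : Term) : Term := .add (.mul boundT (.add (.mul boundT e₁) e₂)) e₃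

theorem eval_ixT (w : List ℕ) (τ : Tables) (ρ : ℕ → ℕ) (e₁ e₂ e₃ : Term) :
    (ixT e₁ e₂ e₃).eval w τ ρ =
      ix (w.length + 1) (e₁.eval w τ ρ) (e₂.eval w τ ρ) (e₃.eval w τ ρ) := by
  simp [ixT, Term.eval, eval_boundT, ix]

/-- Set the entries `(x, y, z)` of table `a` to the value of `t` in lexicographic order. -/
def fill (a : Fin 8) (t : Term) : Cmd :=
  .forN 0 (.forN 1 (.forN 2 (.store a (ixT (.var 0) (.var 1) (.var 2)) t)))

/-- The three nested loops visit the positions `ix N x y z` in increasing order, and division with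
remainder recovers the coordinates; they flatten into one pass covered by `foldl_store`. -/
theorem run_fill (w : List ℕ) (a : Fin 8) (t : Term) (τ : Tables) :
    let N := w.length + 1
    let τ' := (fill a t).run w (fun _ => 0) τ
    (∀ a', a' ≠ a → τ' a' = τ a') ∧ ∀ x < N, ∀ y < N, ∀ z < N, ∃ σ : Tables,
      τ' a (ix N x y z) = t.eval w σ (env3 x y z) ∧
      (∀ a', a' ≠ a → σ a' = τ a') ∧ ∀ i < ix N x y z, σ a i = τ' a i := by
  intro N τ'
  let F : ℕ → Tables → ℕ := fun p τ => t.eval w τ (env3 (p / N / N) (p / N % N) (p % N))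
  have hdec : ∀ x < N, ∀ y < N, ∀ z < N, ix N x y z / N / N = x ∧ ix N x y z / N % N = y ∧
      ix N x y z % N = z := by
    intro x hx y hy z hz
    have hN : 0 < N := by omega
    have h1 : ix N x y z / N = N * x + y := by
      rw [ix, Nat.mul_add_div hN, Nat.div_eq_of_lt hz, add_zero]
    refine ⟨?_, ?_, ?_⟩
    · rw [h1, Nat.mul_add_div hN, Nat.div_eq_of_lt hy, add_zero]
    · rw [h1, Nat.mul_add_mod, Nat.mod_eq_of_lt hy]
    · rw [ix, Nat.mul_add_mod, Nat.mod_eq_of_lt hz]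
  have hτ' : τ' = (List.range (N * N * N)).foldl
      (fun τ p => Function.update τ a (Function.update (τ a) p (F p τ))) τ := by
    rw [foldl_range_mul, foldl_range_mul]
    simp only [τ', fill, Cmd.run]
    refine List.foldl_ext _ _ _ fun τ₁ x hx => List.foldl_ext _ _ _ fun τ₂ y hy =>
      List.foldl_ext _ _ _ fun τ₃ z hz => ?_
    rw [List.mem_range] at hx hy hz
    have hp : (x * N + y) * N + z = ix N x y z := by rw [ix]; ring
    obtain ⟨h₁, h₂, h₃⟩ := hdec x hx y hy z hz
    rw [hp, update_env3]
    simp only [F, h₁, h₂, h₃, eval_ixT, Term.eval, env3_zero, env3_one, env3_two]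
    rfl
  have key := foldl_store a F τ (N * N * N)
  rw [← hτ'] at key
  refine ⟨key.1, fun x hx y hy z hz => ?_⟩
  have hlt : ix N x y z < N * N * N := by
    have h1 : N * x + y < N * N := by nlinarith
    calc ix N x y z = N * (N * x + y) + z := rfl
      _ < N * (N * x + y) + N := by omega
      _ = N * (N * x + y + 1) := by ring
      _ ≤ N * (N * N) := Nat.mul_le_mul_left _ h1
      _ = N * N * N := by ring
  obtain ⟨σ, h₁, h₂, h₃⟩ := key.2 _ hlt
  refine ⟨σ, ?_, h₂, h₃⟩
  obtain ⟨k₁, k₂, k₃⟩ := hdec x hx y hy z hz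
  rw [h₁]
  simp only [F, k₁, k₂, k₃]

/-- Justifies recursion on the first coordinate: all entries with a smaller one are already final.
-/
theorem ix_lt_ix {N x x' y y' z z' : ℕ} (hx : x < x') (hy : y < N) (hz : z < N) :
    ix N x y z < ix N x' y' z' := by
  have h1 : N * x + y + 1 ≤ N * x' + y' := by nlinarith
  calc ix N x y z < N * (N * x + y) + N := by unfold ix; omega
    _ = N * (N * x + y + 1) := by ring
    _ ≤ N * (N * x' + y') := Nat.mul_le_mul_left _ h1
    _ ≤ ix N x' y' z' := Nat.le_add_right _ _

/-! ## The encoding of an instance -/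

theorem getD_flatMap {α : Type*} (m : ℕ) (g : α → List ℕ) (hg : ∀ a, (g a).length = m)
    (l : List α) (i j : ℕ) (hi : i < l.length) (hj : j < m) (r : List ℕ) :
    (l.flatMap g ++ r).getD (i * m + j) 0 = (g l[i]).getD j 0 := by
  induction l generalizing i with
  | nil => simp at hi
  | cons a l ih =>
    rw [List.flatMap_cons, List.append_assoc]
    cases i with
    | zero =>
      rw [List.getD_append _ _ _ _ (by rw [hg]; omega)]
      simp
    | succ i =>
      have : (i + 1) * m + j = (g a).length + (i * m + j) := by rw [hg]; ring
      rw [this, List.getD_append_right _ _ _ _ (by omega), Nat.add_sub_cancel_left,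
        ih i (by simpa using hi)]
      simp

theorem length_flatMap_const {α : Type*} (m : ℕ) (g : α → List ℕ) (hg : ∀ a, (g a).length = m)
    (l : List α) : (l.flatMap g).length = l.length * m := by
  induction l with
  | nil => simp
  | cons a l ih => rw [List.flatMap_cons, List.length_append, ih, hg, List.length_cons]; ring

namespace Instance
variable (I : Instance)

theorem length_encode : I.encode.length = I.n * I.n + I.n + 2 := by
  classical
  simp only [encode, List.length_cons, List.length_append, List.length_map, List.length_finRange]
  rw [length_flatMap_const I.n _ (fun _ => by simp), List.length_finRange]

open Classical in
theorem load_encode_adj (u v : Fin I.n) :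
    load I.encode (3 + u.val * I.n + v.val) = if I.G.Adj u v then 1 else 0 := by
  have : 3 + u.val * I.n + v.val = (u.val * I.n + v.val) + 1 + 1 + 1 := by omega
  rw [this]
  simp only [load, encode, List.getD_cons_succ]
  rw [getD_flatMap I.n _ (fun _ => by simp) _ _ _ (by simp) v.isLt]
  simp

open Classical in
theorem load_encode_mem (v : Fin I.n) :
    load I.encode (3 + I.n * I.n + v.val) = if v ∈ I.S then 1 else 0 := by
  have : 3 + I.n * I.n + v.val = (I.n * I.n + v.val) + 1 + 1 + 1 := by omega
  rw [this]
  simp only [load, encode, List.getD_cons_succ]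
  have hl := length_flatMap_const I.n (fun u : Fin I.n => (List.finRange I.n).map
    fun v => if I.G.Adj u v then 1 else 0) (fun _ => by simp) (List.finRange I.n)
  rw [List.length_finRange] at hl
  rw [List.getD_append_right _ _ _ _ (by rw [hl]; omega), hl, Nat.add_sub_cancel_left]
  simp

/-- The side length of the tables. -/
noncomputable def N : ℕ := I.encode.length + 1

theorem N_eq : I.N = I.n * I.n + I.n + 3 := by rw [N, length_encode]

theorem lt_N (v : Fin I.n) : v.val < I.N := by
  have := v.isLt
  rw [N_eq]
  nlinarith

theorem n_lt_N : I.n < I.N := by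
  rw [N_eq]; nlinarith

/-- The value of a term for the input word that encodes the instance. -/
noncomputable def ev (τ : Tables) (ρ : ℕ → ℕ) (t : Term) : ℕ := t.eval I.encode τ ρ

/-- A term, read as a formula, is true if its value is not zero. -/
def Tr (τ : Tables) (ρ : ℕ → ℕ) (t : Term) : Prop := I.ev τ ρ t ≠ 0

end Instance

/-- Equality or adjacency of two vertices. -/
def ClosedAdj {n : ℕ} (G : SimpleGraph (Fin n)) (u v : Fin n) : Prop := u = v ∨ G.Adj u v

/-! ## Formulas -/

def notT (a : Term) : Term := .sub (.lit 1) a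
def andT (a b : Term) : Term := .ite a b (.lit 0)
def orT (a b : Term) : Term := .ite a (.lit 1) b
def iffT (a b : Term) : Term := .ite a b (notT b)
def ltT (a b : Term) : Term := notT (.sub (.add a (.lit 1)) b)
def eqT (a b : Term) : Term := notT (.add (.sub a b) (.sub b a))
def nT : Term := .inp (.lit 1)
/-- The sum over all vertices. -/
def sumV (x : ℕ) (t : Term) : Term := .sum x (.ite (ltT (.var x) nT) t (.lit 0))
/-- The number of vertices with a given property. -/
def cardV (x : ℕ) (t : Term) : Term := sumV x (.ite t (.lit 1) (.lit 0))
def adjT (x y : ℕ) : Term := .inp (.add (.add (.lit 3) (.mul (.var x) nT)) (.var y))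
/-- Equality or adjacency of two vertices. -/
def cadjT (x y : ℕ) : Term := orT (eqT (.var x) (.var y)) (adjT x y)
def memT (x : ℕ) : Term := .inp (.add (.add (.lit 3) (.mul nT nT)) (.var x))
/-- The number of tokens. -/
def kT : Term := cardV 9 (memT 9)
def tab3 (a : Fin 8) (e₁ e₂ e₃ : Term) : Term := .tab a (ixT e₁ e₂ e₃)

namespace Instance
variable (I : Instance) (τ : Tables) (ρ : ℕ → ℕ)

@[simp] theorem ev_lit (c : ℕ) : I.ev τ ρ (.lit c) = c := rfl
@[simp] theorem ev_var (x : ℕ) : I.ev τ ρ (.var x) = ρ x := rfl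
@[simp] theorem ev_add (a b : Term) : I.ev τ ρ (.add a b) = I.ev τ ρ a + I.ev τ ρ b := rfl
@[simp] theorem ev_sub (a b : Term) : I.ev τ ρ (.sub a b) = I.ev τ ρ a - I.ev τ ρ b := rfl
@[simp] theorem ev_inp (a : Term) : I.ev τ ρ (.inp a) = load I.encode (I.ev τ ρ a) := rfl
theorem ev_mul (a b : Term) : I.ev τ ρ (.mul a b) = min (I.ev τ ρ a) I.N * I.ev τ ρ b := rfl

/-- The first factors of the products in the algorithm are at most N, so the cap has no effect on
them. -/
theorem ev_mul_of_le {a : Term} (b : Term) (h : I.ev τ ρ a ≤ I.N) :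
    I.ev τ ρ (.mul a b) = I.ev τ ρ a * I.ev τ ρ b := by rw [ev_mul, min_eq_left h]

@[simp] theorem ev_ite (c a b : Term) [Decidable (I.Tr τ ρ c)] :
    I.ev τ ρ (.ite c a b) = if I.Tr τ ρ c then I.ev τ ρ a else I.ev τ ρ b := by
  unfold Tr ev at *
  rw [Term.eval]
  congr

theorem ev_sum (x : ℕ) (t : Term) : I.ev τ ρ (.sum x t) =
    ∑ i ∈ Finset.range I.N, I.ev τ (Function.update ρ x i) t := rfl

@[simp] theorem ev_tab3 (a : Fin 8) (e₁ e₂ e₃ : Term) : I.ev τ ρ (tab3 a e₁ e₂ e₃) =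
    τ a (ix I.N (I.ev τ ρ e₁) (I.ev τ ρ e₂) (I.ev τ ρ e₃)) := by
  simp only [ev, tab3, Term.eval, eval_ixT]; rfl

@[simp] theorem tr_not (a : Term) : I.Tr τ ρ (notT a) ↔ ¬ I.Tr τ ρ a := by
  simp only [Tr, notT, ev_sub, ev_lit]; omega

@[simp] theorem tr_and (a b : Term) : I.Tr τ ρ (andT a b) ↔ I.Tr τ ρ a ∧ I.Tr τ ρ b := by
  classical
  rw [Tr, andT, ev_ite]
  unfold Tr at *
  split_ifs with h
  · tauto
  · simp [not_not.mp h]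

@[simp] theorem tr_or (a b : Term) : I.Tr τ ρ (orT a b) ↔ I.Tr τ ρ a ∨ I.Tr τ ρ b := by
  classical
  rw [Tr, orT, ev_ite]
  unfold Tr at *
  split_ifs with h <;> simp [h]

@[simp] theorem tr_iff (a b : Term) : I.Tr τ ρ (iffT a b) ↔ (I.Tr τ ρ a ↔ I.Tr τ ρ b) := by
  classical
  rw [Tr, iffT, ev_ite]
  split_ifs with h
  · rw [← Tr]; tauto
  · rw [← Tr, tr_not]; tauto

@[simp] theorem tr_lt (a b : Term) : I.Tr τ ρ (ltT a b) ↔ I.ev τ ρ a < I.ev τ ρ b := by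
  rw [ltT, tr_not, Tr]; simp only [ev_sub, ev_add, ev_lit]; omega

@[simp] theorem tr_eq (a b : Term) : I.Tr τ ρ (eqT a b) ↔ I.ev τ ρ a = I.ev τ ρ b := by
  rw [eqT, tr_not, Tr]; simp only [ev_sub, ev_add]; omega

@[simp] theorem ev_nT : I.ev τ ρ nT = I.n := rfl

@[simp] theorem ev_sumV (x : ℕ) (t : Term) : I.ev τ ρ (sumV x t) =
    ∑ u : Fin I.n, I.ev τ (Function.update ρ x u) t := by
  classical
  rw [sumV, ev_sum]
  simp only [ev_ite, tr_lt, ev_var, Function.update_self, ev_nT, ev_lit]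
  rw [← Finset.sum_filter]
  have : (Finset.range I.N).filter (· < I.n) = Finset.range I.n := by
    ext i; simp only [Finset.mem_filter, Finset.mem_range]; have := I.n_lt_N; omega
  rw [this, Finset.sum_range]

@[simp] theorem tr_sumV (x : ℕ) (t : Term) : I.Tr τ ρ (sumV x t) ↔
    ∃ u : Fin I.n, I.Tr τ (Function.update ρ x u) t := by
  rw [Tr, ev_sumV, Ne, Finset.sum_eq_zero_iff]
  simp [Tr]

open Classical in
@[simp] theorem ev_cardV (x : ℕ) (t : Term) : I.ev τ ρ (cardV x t) =
    (Finset.univ.filter fun u : Fin I.n => I.Tr τ (Function.update ρ x u) t).card := by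
  rw [cardV, ev_sumV, Finset.card_filter]
  exact Finset.sum_congr rfl fun u _ => by simp

variable {τ ρ}

open Classical in
theorem ev_adjT {x y : ℕ} {u v : Fin I.n} (hx : ρ x = u) (hy : ρ y = v) :
    I.ev τ ρ (adjT x y) = if I.G.Adj u v then 1 else 0 := by
  rw [adjT, ev_inp, ev_add, ev_add, ev_mul_of_le _ _ _ _ (by
    rw [ev_var, hx]; exact (I.lt_N u).le), ev_var, ev_var, hx, hy]
  exact I.load_encode_adj u v

theorem tr_adjT {x y : ℕ} {u v : Fin I.n} (hx : ρ x = u) (hy : ρ y = v) :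
    I.Tr τ ρ (adjT x y) ↔ I.G.Adj u v := by
  classical
  rw [Tr, I.ev_adjT hx hy]; simp

theorem tr_cadjT {x y : ℕ} {u v : Fin I.n} (hx : ρ x = u) (hy : ρ y = v) :
    I.Tr τ ρ (cadjT x y) ↔ ClosedAdj I.G u v := by
  rw [cadjT, tr_or, tr_eq, I.tr_adjT hx hy, ev_var, ev_var, hx, hy, ClosedAdj, Fin.ext_iff]

open Classical in
theorem ev_memT {x : ℕ} {u : Fin I.n} (hx : ρ x = u) :
    I.ev τ ρ (memT x) = if u ∈ I.S then 1 else 0 := by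
  rw [memT, ev_inp, ev_add, ev_add, ev_mul_of_le _ _ _ _ (by
    rw [ev_nT]; exact I.n_lt_N.le), ev_var, hx]
  exact I.load_encode_mem u

theorem tr_memT {x : ℕ} {u : Fin I.n} (hx : ρ x = u) :
    I.Tr τ ρ (memT x) ↔ u ∈ I.S := by
  classical
  rw [Tr, I.ev_memT hx]; simp

@[simp] theorem ev_kT : I.ev τ ρ kT = I.tokens := by
  classical
  rw [kT, ev_cardV, tokens]
  congr 1
  ext u
  simp only [Finset.mem_filter, Finset.mem_univ, true_and]
  exact I.tr_memT (by simp)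

theorem tokens_le : I.tokens ≤ I.n := by
  simpa [tokens] using Finset.card_le_univ I.S

end Instance

/-! ## Domination cores -/

theorem ClosedAdj.symm {n : ℕ} {G : SimpleGraph (Fin n)} {u v : Fin n} (h : ClosedAdj G u v) :
    ClosedAdj G v u := h.elim (fun h => .inl h.symm) fun h => .inr h.symm

/-- Upper bound for the number of core vertices with `d - i` common closed neighbours. -/
def coreBound (d k : ℕ) : ℕ → ℕ
  | 0 => 2 * d
  | i + 1 => k * coreBound d k i + 1

section
variable {n : ℕ} {G : SimpleGraph (Fin n)} {d k : ℕ} {C : Finset (Fin n)}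

open Classical in
/-- The vertices of `C` whose closed neighbourhood contains `X`. -/
noncomputable def common (G : SimpleGraph (Fin n)) (C X : Finset (Fin n)) : Finset (Fin n) :=
  C.filter fun u => ∀ x ∈ X, ClosedAdj G x u

theorem mem_common {X : Finset (Fin n)} {u : Fin n} :
    u ∈ common G C X ↔ u ∈ C ∧ ∀ x ∈ X, ClosedAdj G x u := by simp [common]

/-- `C` is obtained by greedily adding the vertices in increasing order, unless a set `X` of at most
`d` closed neighbours is already contained in too many closed neighbourhoods of `C`. -/
def IsCore (G : SimpleGraph (Fin n)) (d k : ℕ) (C : Finset (Fin n)) : Prop :=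
  ∀ v, v ∈ C ↔ ¬ ∃ X : Finset (Fin n), X.card ≤ d ∧ (∀ x ∈ X, ClosedAdj G x v) ∧
    coreBound d k (d - X.card) ≤ ((common G C X).filter (· < v)).card

/-- Of `2 * d` common closed neighbours, at least `d` lie outside `X`; these are adjacent to all of
`X` and form a biclique with it. -/
theorem card_common_lt (hG : (completeBipartiteGraph (Fin d) (Fin d)).Free G)
    (C X : Finset (Fin n)) (hX : X.card = d) : (common G C X).card < 2 * d := by
  by_contra! h
  apply hG
  have h1 : d ≤ (common G C X \ X).card := by
    have := Finset.le_card_sdiff X (common G C X)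
    omega
  obtain ⟨Y, hY, hYd⟩ := Finset.exists_subset_card_eq h1
  let f := X.equivFinOfCardEq hX
  let g := Y.equivFinOfCardEq hYd
  have hadj : ∀ x ∈ X, ∀ y ∈ Y, G.Adj x y := by
    intro x hx y hy
    have hy' := Finset.mem_sdiff.mp (hY hy)
    rcases (mem_common.mp hy'.1).2 x hx with rfl | h
    · exact absurd hx hy'.2
    · exact h
  refine ⟨⟨⟨Sum.elim (fun i => (f.symm i : Fin n)) (fun i => (g.symm i : Fin n)), ?_⟩, ?_⟩⟩
  · rintro (a | a) (b | b) hab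
    · simp at hab
    · exact hadj _ (f.symm a).2 _ (g.symm b).2
    · exact (hadj _ (f.symm b).2 _ (g.symm a).2).symm
    · simp at hab
  · rintro (a | a) (b | b) hab
    · simpa [Subtype.ext_iff] using hab
    · exact absurd hab (hadj _ (f.symm a).2 _ (g.symm b).2).ne
    · exact absurd hab.symm (hadj _ (f.symm b).2 _ (g.symm a).2).ne
    · simpa [Subtype.ext_iff] using hab

/-- The largest vertex of `common G C X` was admitted to `C`, so fewer than the bound precede it. -/
theorem IsCore.card_common_le (hC : IsCore G d k C) {X : Finset (Fin n)} (hX : X.card ≤ d) :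
    (common G C X).card ≤ coreBound d k (d - X.card) := by
  rcases (common G C X).eq_empty_or_nonempty with h | h
  · simp [h]
  set v := (common G C X).max' h
  have hv : v ∈ common G C X := Finset.max'_mem _ _
  have hv' := mem_common.mp hv
  have h1 := (hC v).mp hv'.1
  push Not at h1
  have h2 := h1 X hX hv'.2
  have h3 : common G C X ⊆ insert v ((common G C X).filter (· < v)) := by
    intro u hu
    rcases (Finset.le_max' _ u hu).lt_or_eq with h | h
    · exact Finset.mem_insert_of_mem (Finset.mem_filter.mpr ⟨hu, h⟩)
    · exact Finset.mem_insert.mpr (.inl h)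
  have := (Finset.card_le_card h3).trans (Finset.card_insert_le _ _)
  omega

/-- For `X = ∅` every vertex of `C` counts as a common neighbour. -/
theorem IsCore.card_le (hC : IsCore G d k C) : C.card ≤ coreBound d k d := by
  have := hC.card_common_le (X := ∅) (by simp)
  have h : common G C ∅ = C := by ext; simp [mem_common]
  simpa [h] using this

/-- A set of at most `k` vertices that dominates a core dominates the graph. -/
theorem IsCore.dominates (hC : IsCore G d k C)
    (hG : (completeBipartiteGraph (Fin d) (Fin d)).Free G) {D : Finset (Fin n)}
    (hD : D.card ≤ k) (hDC : ∀ c ∈ C, ∃ u ∈ D, ClosedAdj G u c) (v : Fin n) :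
    ∃ u ∈ D, ClosedAdj G u v := by
  by_cases hv : v ∈ C
  · exact hDC v hv
  obtain ⟨X, hXd, hXv, hX⟩ := not_not.mp (mt (hC v).mpr hv)
  have hle : coreBound d k (d - X.card) ≤ (common G C X).card :=
    hX.trans (Finset.card_le_card (Finset.filter_subset _ _))
  -- The case |X| = d contradicts biclique-freeness, because `coreBound d k 0 = 2 * d`.
  rcases hXd.lt_or_eq with hlt | heq
  swap
  · have := card_common_lt hG C X heq
    rw [heq, Nat.sub_self, coreBound] at hle
    omega
  -- If `D` does not dominate `v`, it misses `X`. The common neighbours of `X` in `C` are then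
  -- covered by those of the larger sets `insert u X` with `u ∈ D`.
  by_contra! hno
  have hdisj : ∀ u ∈ D, u ∉ X := fun u hu hx => hno u hu (hXv u hx)
  have hsub : common G C X ⊆ D.biUnion fun u => common G C (insert u X) := by
    intro c hc
    have hc' := mem_common.mp hc
    obtain ⟨u, hu, huc⟩ := hDC c hc'.1
    refine Finset.mem_biUnion.mpr ⟨u, hu, mem_common.mpr ⟨hc'.1, fun x hx => ?_⟩⟩
    rcases Finset.mem_insert.mp hx with rfl | hx
    · exact huc
    · exact hc'.2 x hx
  have hcard : (common G C X).card ≤ D.card * coreBound d k (d - (X.card + 1)) := by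
    refine (Finset.card_le_card hsub).trans (Finset.card_biUnion_le_card_mul _ _ _ fun u hu => ?_)
    have hcu : (insert u X).card = X.card + 1 := Finset.card_insert_of_notMem (hdisj u hu)
    have := hC.card_common_le (X := insert u X) (by omega)
    rwa [hcu] at this
  -- The recursion of `coreBound` is chosen so that `k` such pieces fall short by one.
  have heq : d - X.card = (d - (X.card + 1)) + 1 := by omega
  rw [heq, coreBound] at hle
  have := Nat.mul_le_mul_right (coreBound d k (d - (X.card + 1))) hD
  omega

/-! ## Neighbourhood types -/

open Classical in
/-- The closed neighbours of `v` in `C`. -/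
noncomputable def nbType (G : SimpleGraph (Fin n)) (C : Finset (Fin n)) (v : Fin n) :
    Finset (Fin n) := C.filter fun c => ClosedAdj G v c

theorem mem_nbType {v c : Fin n} : c ∈ nbType G C v ↔ c ∈ C ∧ ClosedAdj G v c := by
  simp [nbType]

/-- A type with fewer than `d` elements is a small subset of `C`. A larger one contains a `d`-set `X
⊆ C`, and any vertex of that type is among the fewer than `2 * d` common closed neighbours of `X`.
-/
theorem card_image_nbType_le (hG : (completeBipartiteGraph (Fin d) (Fin d)).Free G)
    (C : Finset (Fin n)) :
    (Finset.univ.image (nbType G C)).card ≤ d * (C.card + 1) ^ d + C.card ^ d * (2 * d) := by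
  classical
  have hsub : Finset.univ.image (nbType G C) ⊆
      ((Finset.range d).biUnion fun i => C.powersetCard i) ∪
      ((C.powersetCard d).biUnion fun X => common G Finset.univ X).image (nbType G C) := by
    intro T hT
    obtain ⟨v, -, rfl⟩ := Finset.mem_image.mp hT
    have hTC : nbType G C v ⊆ C := fun c hc => (mem_nbType.mp hc).1
    by_cases h : (nbType G C v).card < d
    · refine Finset.mem_union_left _ (Finset.mem_biUnion.mpr ⟨_, Finset.mem_range.mpr h, ?_⟩)
      exact Finset.mem_powersetCard.mpr ⟨hTC, rfl⟩
    · obtain ⟨X, hX, hXd⟩ := Finset.exists_subset_card_eq (not_lt.mp h)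
      refine Finset.mem_union_right _ (Finset.mem_image_of_mem _ (Finset.mem_biUnion.mpr
        ⟨X, Finset.mem_powersetCard.mpr ⟨hX.trans hTC, hXd⟩, ?_⟩))
      exact mem_common.mpr ⟨Finset.mem_univ _, fun x hx => (mem_nbType.mp (hX hx)).2.symm⟩
  refine (Finset.card_le_card hsub).trans ((Finset.card_union_le _ _).trans
    (add_le_add ?_ (Finset.card_image_le.trans ?_)))
  · refine (Finset.card_biUnion_le_card_mul _ _ ((C.card + 1) ^ d) fun i hi => ?_).trans
      (by simp)
    rw [Finset.card_powersetCard]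
    calc C.card.choose i ≤ C.card ^ i := Nat.choose_le_pow _ _
      _ ≤ (C.card + 1) ^ i := Nat.pow_le_pow_left (by omega) _
      _ ≤ (C.card + 1) ^ d := Nat.pow_le_pow_right (by omega) (Finset.mem_range.mp hi).le
  · refine (Finset.card_biUnion_le_card_mul _ _ (2 * d) fun X hX => ?_).trans
      (Nat.mul_le_mul_right _ ?_)
    · exact (card_common_lt hG _ X (Finset.mem_powersetCard.mp hX).2).le
    · rw [Finset.card_powersetCard]; exact Nat.choose_le_pow _ _

end

/-! ## Sequences of slides -/

section
variable {n : ℕ} {G : SimpleGraph (Fin n)}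

/-- `D` is obtained from `C` by `l` slides. -/
inductive Slides (G : SimpleGraph (Fin n)) : ℕ → Finset (Fin n) → Finset (Fin n) → Prop
  | refl (C : Finset (Fin n)) : Slides G 0 C C
  | step {l : ℕ} {C C' D : Finset (Fin n)} : Slide G C C' → Slides G l C' D → Slides G (l + 1) C D

theorem slides_iff {l : ℕ} {C D : Finset (Fin n)} : Slides G l C D ↔
    ∃ F : ℕ → Finset (Fin n), F 0 = C ∧ (∀ i < l, Slide G (F i) (F (i + 1))) ∧ F l = D := by
  constructor
  · intro h
    induction h with
    | refl C => exact ⟨fun _ => C, rfl, by simp, rfl⟩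
    | @step l C C' D h₁ _ ih =>
      obtain ⟨F, h0, hF, hl⟩ := ih
      refine ⟨fun i => Nat.casesOn i C F, rfl, fun i hi => ?_, hl⟩
      cases i with
      | zero =>
        change Slide G C (F 0)
        rwa [h0]
      | succ i => exact hF i (by omega)
  · rintro ⟨F, rfl, hF, rfl⟩
    induction l generalizing F with
    | zero => exact .refl _
    | succ l ih =>
      exact .step (hF 0 (by omega)) (ih (fun i => F (i + 1)) fun i hi => hF (i + 1) (by omega))

theorem Instance.isYes_iff (I : Instance) : I.IsYes ↔
    ∃ l ≤ I.b, ∃ D, Slides I.G l I.S D ∧ IsDominatingSet I.G D := by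
  constructor
  · rintro ⟨l, F, hl, h0, hF, hD⟩
    exact ⟨l, hl, _, slides_iff.mpr ⟨F, h0, hF, rfl⟩, hD⟩
  · rintro ⟨l, hl, D, hD, hdom⟩
    obtain ⟨F, h0, hF, rfl⟩ := slides_iff.mp hD
    exact ⟨l, F, hl, h0, hF, hdom⟩

theorem Slide.card_eq {C C' : Finset (Fin n)} (h : Slide G C C') : C'.card = C.card := by
  obtain ⟨y, hy, x, hx, -, rfl⟩ := h
  rw [Finset.card_insert_of_notMem fun h => hx (Finset.mem_of_mem_erase h),
    Finset.card_erase_add_one hy]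

theorem Slides.card_eq {l : ℕ} {C D : Finset (Fin n)} (h : Slides G l C D) : D.card = C.card := by
  induction h with
  | refl => rfl
  | step h _ ih => rw [ih, h.card_eq]

theorem isDominatingSet_iff {D : Finset (Fin n)} :
    IsDominatingSet G D ↔ ∀ v, ∃ u ∈ D, ClosedAdj G u v := by
  refine forall_congr' fun v => ⟨?_, ?_⟩
  · rintro (h | ⟨u, hu, h⟩)
    · exact ⟨v, h, .inl rfl⟩
    · exact ⟨u, hu, .inr h⟩
  · rintro ⟨u, hu, rfl | h⟩
    · exact .inl hu
    · exact .inr ⟨u, hu, h⟩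

/-- There is a walk of length `l` from `u` to `v`. -/
def HasWalk (G : SimpleGraph (Fin n)) (u v : Fin n) (l : ℕ) : Prop :=
  ∃ p : G.Walk u v, p.length = l

theorem HasWalk.refl (u : Fin n) : HasWalk G u u 0 := ⟨.nil, rfl⟩

theorem HasWalk.eq {u v : Fin n} (h : HasWalk G u v 0) : u = v :=
  SimpleGraph.Walk.eq_of_length_eq_zero h.choose_spec

theorem HasWalk.trans {u v w : Fin n} {a b : ℕ} (h : HasWalk G u v a) (h' : HasWalk G v w b) :
    HasWalk G u w (a + b) := by
  obtain ⟨p, rfl⟩ := h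
  obtain ⟨q, rfl⟩ := h'
  exact ⟨p.append q, by simp⟩

theorem hasWalk_one {u v : Fin n} (h : G.Adj u v) : HasWalk G u v 1 := ⟨.cons h .nil, rfl⟩

/-- Split the walk at its first edge leaving `C`; a token can legally slide along that edge. -/
theorem HasWalk.exists_boundary {u v : Fin n} {l : ℕ} (h : HasWalk G u v l) {C : Finset (Fin n)}
    (hu : u ∈ C) (hv : v ∉ C) : ∃ a b x y, HasWalk G u x a ∧ x ∈ C ∧ y ∉ C ∧ G.Adj x y ∧
      HasWalk G y v b ∧ a + 1 + b = l := by
  obtain ⟨p, rfl⟩ := h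
  induction p with
  | nil => exact absurd hu hv
  | @cons u w v hadj p ih =>
    by_cases hw : w ∈ C
    · obtain ⟨a, b, x, y, h₁, h₂, h₃, h₄, h₅, h₆⟩ := ih hw hv
      refine ⟨a + 1, b, x, y, ?_, h₂, h₃, h₄, h₅, ?_⟩
      · rw [add_comm]; exact (hasWalk_one hadj).trans h₁
      · rw [SimpleGraph.Walk.length_cons]; omega
    · exact ⟨0, p.length, u, w, .refl u, hu, hw, hadj, ⟨p, rfl⟩, by
        rw [SimpleGraph.Walk.length_cons]; omega⟩

/-- Tokens that start at distinct vertices can be moved to any given targets within the total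
length of walks to these targets, even if the walks or targets collide. -/
theorem exists_slides_of_walks {ι : Type*} [DecidableEq ι] (J : Finset ι) (r : ι → Fin n) (b : ℕ)
    (C : Finset (Fin n)) (g : ι → Fin n) (ℓ : ι → ℕ) (hg : Set.InjOn g J)
    (hgC : ∀ j ∈ J, g j ∈ C) (hw : ∀ j ∈ J, HasWalk G (g j) (r j) (ℓ j))
    (hb : ∑ j ∈ J, ℓ j ≤ b) :
    ∃ l ≤ b, ∃ D, Slides G l C D ∧ ∀ j ∈ J, r j ∈ D := by
  induction b generalizing C g ℓ with
  | zero =>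
    refine ⟨0, le_rfl, C, .refl C, fun j hj => ?_⟩
    have h0 : ℓ j = 0 := by
      have := Finset.single_le_sum (f := ℓ) (fun _ _ => Nat.zero_le _) hj
      omega
    have := hw j hj
    rw [h0] at this
    rw [← this.eq]
    exact hgC j hj
  | succ b ih =>
    by_cases hall : ∀ j ∈ J, r j ∈ C
    · exact ⟨0, by omega, C, .refl C, hall⟩
    push Not at hall
    obtain ⟨j, hj, hjC⟩ := hall
    -- The target of `j` is unoccupied, so its walk leaves the configuration along some edge from
    -- `s` to `x`. The token on `s` slides to `x` and serves `j` from there, with only `β` steps to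
    -- go.
    obtain ⟨α, β, s, x, h₁, hs, hx, hadj, h₂, hαβ⟩ := (hw j hj).exists_boundary (hgC j hj) hjC
    have hslide : Slide G C (insert x (C.erase s)) := ⟨s, hs, x, hx, hadj.symm, rfl⟩
    have hsum : ∑ i ∈ J, ℓ i = ℓ j + ∑ i ∈ J.erase j, ℓ i := (Finset.add_sum_erase _ _ hj).symm
    suffices h : ∃ (g' : ι → Fin n) (ℓ' : ι → ℕ), Set.InjOn g' J ∧
        (∀ i ∈ J, g' i ∈ insert x (C.erase s)) ∧ (∀ i ∈ J, HasWalk G (g' i) (r i) (ℓ' i)) ∧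
        ∑ i ∈ J, ℓ' i ≤ b by
      obtain ⟨g', ℓ', k₁, k₂, k₃, k₄⟩ := h
      obtain ⟨l, hl, D, hD, hrD⟩ := ih _ g' ℓ' k₁ k₂ k₃ k₄
      exact ⟨l + 1, by omega, D, .step hslide hD, hrD⟩
    have hgx : ∀ i ∈ J, g i ≠ x := fun i hi h => hx (h ▸ hgC i hi)
    -- If that token was meant for another `i`, the two exchange roles: `i` takes over the token at
    -- `g j`, which walks `α` steps to `s` and then follows the old walk of `i`. The total length
    -- drops by exactly one.
    by_cases hcase : ∃ i ∈ J, i ≠ j ∧ g i = s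
    · obtain ⟨i, hi, hij, his⟩ := hcase
      refine ⟨Function.update (Function.update g i (g j)) j x,
        Function.update (Function.update ℓ i (α + ℓ i)) j β, ?_, ?_, ?_, ?_⟩
      · have hsw : ∀ p ∈ J, Equiv.swap i j p ∈ J := fun p hp => by
          rw [Equiv.swap_apply_def]; split_ifs <;> assumption
        have hval : ∀ p, p ≠ j → Function.update (Function.update g i (g j)) j x p =
            g (Equiv.swap i j p) := fun p hpj => by
          rw [Function.update_of_ne hpj]
          by_cases hpi : p = i
          · rw [hpi, Function.update_self, Equiv.swap_apply_left]
          · rw [Function.update_of_ne hpi, Equiv.swap_apply_of_ne_of_ne hpi hpj]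
        intro p hp q hq hpq
        by_cases hpj : p = j <;> by_cases hqj : q = j
        · rw [hpj, hqj]
        · rw [hpj, Function.update_self, hval q hqj] at hpq
          exact absurd hpq.symm (hgx _ (hsw q hq))
        · rw [hqj, Function.update_self, hval p hpj] at hpq
          exact absurd hpq (hgx _ (hsw p hp))
        · rw [hval p hpj, hval q hqj] at hpq
          exact (Equiv.swap i j).injective (hg (hsw p hp) (hsw q hq) hpq)
      · intro p hp
        by_cases hpj : p = j
        · subst hpj
          rw [Function.update_self]
          exact Finset.mem_insert_self _ _
        rw [Function.update_of_ne hpj]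
        refine Finset.mem_insert_of_mem (Finset.mem_erase.mpr ?_)
        by_cases hpi : p = i
        · subst hpi
          rw [Function.update_self]
          exact ⟨fun h => hij (hg hi hj (his.trans h.symm)), hgC j hj⟩
        · rw [Function.update_of_ne hpi]
          exact ⟨fun h => hpi (hg hp hi (h.trans his.symm)), hgC p hp⟩
      · intro p hp
        by_cases hpj : p = j
        · subst hpj
          rw [Function.update_self, Function.update_self]
          exact h₂
        rw [Function.update_of_ne hpj, Function.update_of_ne hpj]
        by_cases hpi : p = i
        · subst hpi
          rw [Function.update_self, Function.update_self]
          exact h₁.trans (his ▸ hw p hi)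
        · rw [Function.update_of_ne hpi, Function.update_of_ne hpi]
          exact hw p hp
      · have hi' : i ∈ J.erase j := Finset.mem_erase.mpr ⟨hij, hi⟩
        rw [Finset.sum_update_of_mem hj, ← Finset.erase_eq, Finset.sum_update_of_mem hi']
        have := Finset.add_sum_erase _ ℓ hi'
        rw [Finset.erase_eq (J.erase j)] at this
        omega
    -- Here the token on `s` belongs to `j` itself or to nobody.
    · push Not at hcase
      refine ⟨Function.update g j x, Function.update ℓ j β, ?_, ?_, ?_, ?_⟩
      · intro p hp q hq hpq
        simp only [Function.update_apply] at hpq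
        split_ifs at hpq with e₁ e₂ e₂
        · rw [e₁, e₂]
        · exact absurd hpq.symm (hgx q hq)
        · exact absurd hpq (hgx p hp)
        · exact hg hp hq hpq
      · intro p hp
        by_cases hpj : p = j
        · subst hpj
          rw [Function.update_self]
          exact Finset.mem_insert_self _ _
        · rw [Function.update_of_ne hpj]
          exact Finset.mem_insert_of_mem (Finset.mem_erase.mpr ⟨hcase p hp hpj, hgC p hp⟩)
      · intro p hp
        by_cases hpj : p = j
        · subst hpj
          rw [Function.update_self, Function.update_self]
          exact h₂
        · rw [Function.update_of_ne hpj, Function.update_of_ne hpj]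
          exact hw p hp
      · rw [Finset.sum_update_of_mem hj, ← Finset.erase_eq]
        omega

/-- Slides move the tokens along walks from distinct starting vertices. -/
theorem Slides.exists_walks {l : ℕ} {C D : Finset (Fin n)} (h : Slides G l C D) :
    ∃ (g : Fin n → Fin n) (ℓ : Fin n → ℕ), Set.InjOn g D ∧ (∀ v ∈ D, g v ∈ C) ∧
      (∀ v ∈ D, HasWalk G (g v) v (ℓ v)) ∧ ∑ v ∈ D, ℓ v ≤ l := by
  induction h with
  | refl C =>
    exact ⟨id, fun _ => 0, Set.injOn_id _, fun _ h => h, fun v _ => .refl v, by simp⟩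
  | @step l C C' D h _ ih =>
    obtain ⟨y, hy, x, hx, hadj, rfl⟩ := h
    obtain ⟨g, ℓ, k₁, k₂, k₃, k₄⟩ := ih
    have hother : ∀ v ∈ D, g v ≠ x → g v ∈ C ∧ g v ≠ y := fun v hv hvx => by
      have := Finset.mem_of_mem_insert_of_ne (k₂ v hv) hvx
      exact ⟨Finset.mem_of_mem_erase this, Finset.ne_of_mem_erase this⟩
    -- The first slide prolongs the walks starting at `x` by the edge from `y`; by injectivity there
    -- is at most one, so the total grows by at most one.
    refine ⟨fun v => if g v = x then y else g v, fun v => ℓ v + if g v = x then 1 else 0,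
      ?_, ?_, ?_, ?_⟩
    · intro p hp q hq hpq
      dsimp only at hpq
      split_ifs at hpq with e₁ e₂ e₂
      · exact k₁ hp hq (e₁.trans e₂.symm)
      · exact absurd hpq.symm (hother q hq e₂).2
      · exact absurd hpq (hother p hp e₁).2
      · exact k₁ hp hq hpq
    · intro v hv
      dsimp only
      split_ifs with e
      · exact hy
      · exact (hother v hv e).1
    · intro v hv
      dsimp only
      split_ifs with e
      · rw [add_comm]; exact (hasWalk_one hadj.symm).trans (e ▸ k₃ v hv)
      · exact k₃ v hv
    · rw [Finset.sum_add_distrib, ← Finset.card_filter]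
      have : (D.filter fun v => g v = x).card ≤ 1 := by
        refine Finset.card_le_one.mpr fun p hp q hq => ?_
        rw [Finset.mem_filter] at hp hq
        exact k₁ hp.1 hq.1 (hp.2.trans hq.2.symm)
      omega

end

/-! ### Distances, representatives, and the vertex set of the kernel -/

section
variable {n : ℕ} {G : SimpleGraph (Fin n)}

theorem HasWalk.exists_split {u v : Fin n} {l : ℕ} (h : HasWalk G u v l) {i : ℕ} (hi : i ≤ l) :
    ∃ x, HasWalk G u x i ∧ HasWalk G x v (l - i) := by
  obtain ⟨p, rfl⟩ := h
  exact ⟨p.getVert i, ⟨p.take i, by simp [hi]⟩, ⟨p.drop i, by simp⟩⟩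

theorem hasWalk_one_iff {u v : Fin n} : HasWalk G u v 1 ↔ G.Adj u v := by
  refine ⟨fun ⟨p, hp⟩ => SimpleGraph.Walk.adj_of_length_eq_one hp, hasWalk_one⟩

theorem ClosedAdj.hasWalk {u v : Fin n} (h : ClosedAdj G u v) : ∃ l ≤ 1, HasWalk G u v l := by
  rcases h with rfl | h
  · exact ⟨0, by omega, .refl u⟩
  · exact ⟨1, le_rfl, hasWalk_one h⟩

/-- With a dominating set of size at most `k`, all finite distances are at most `3 * k`. -/
theorem HasWalk.exists_le_of_isDominatingSet {s v : Fin n} {l k : ℕ} (h : HasWalk G s v l)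
    {D : Finset (Fin n)} (hD : IsDominatingSet G D) (hk : D.card ≤ k) :
    ∃ l' ≤ 3 * k, HasWalk G s v l' := by
  classical
  have hex : ∃ l, HasWalk G s v l := ⟨l, h⟩
  set m := Nat.find hex
  have hm : HasWalk G s v m := Nat.find_spec hex
  refine ⟨m, ?_, hm⟩
  by_contra! hlt
  -- On a shortest walk longer than `3 * k`, take the `k + 1` vertices at distances 0, 3, …, 3k from
  -- `s`.
  have hx : ∀ i, i ≤ k → ∃ x, HasWalk G s x (3 * i) ∧ HasWalk G x v (m - 3 * i) :=
    fun i hi => hm.exists_split (by omega)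
  have : Nonempty (Fin n) := ⟨s⟩
  choose! x hx₁ hx₂ using hx
  choose f hfD hf using isDominatingSet_iff.mp hD
  -- A common dominator of two of them would replace at least three steps by at most two.
  have hinj : ∀ i ≤ k, ∀ j ≤ k, i < j → f (x i) ≠ f (x j) := by
    intro i hi j hj hij heq
    obtain ⟨a, ha, h₁⟩ := (hf (x i)).symm.hasWalk
    obtain ⟨b, hb, h₂⟩ := (hf (x j)).hasWalk
    rw [← heq] at h₂
    have := Nat.find_min' hex (((hx₁ i hi).trans h₁).trans (h₂.trans (hx₂ j hj)))
    omega
  have hcard := Finset.card_le_card_of_injOn (s := Finset.range (k + 1)) (t := D)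
    (fun i => f (x i)) (fun i _ => hfD _) (by
      intro i hi j hj hij
      simp only [Finset.coe_range, Set.mem_Iio] at hi hj
      rcases lt_trichotomy i j with h | h | h
      · exact absurd hij (hinj i (by omega) j (by omega) h)
      · exact h
      · exact absurd hij.symm (hinj j (by omega) i (by omega) h))
  rw [Finset.card_range] at hcard
  omega

/-- `v` is the first neighbour of `w` that is closer to `s`, with respect to the distances `δ`. -/
def IsParent (G : SimpleGraph (Fin n)) (δ : Fin n → Fin n → ℕ) (s w v : Fin n) : Prop :=
  (G.Adj v w ∧ δ s v + 1 = δ s w) ∧ ¬ ∃ u, u < v ∧ G.Adj u w ∧ δ s u + 1 = δ s w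

theorem IsParent.unique {δ : Fin n → Fin n → ℕ} {s w v v' : Fin n} (h : IsParent G δ s w v)
    (h' : IsParent G δ s w v') : v = v' := by
  rcases lt_trichotomy v v' with hv | hv | hv
  · exact absurd ⟨v, hv, h.1⟩ h'.2
  · exact hv
  · exact absurd ⟨v', hv, h'.1⟩ h.2

/-- The data from which the vertex set `K` of the kernel is built: a domination core `C`, the
distances `δ`, for each token and each neighbourhood type a closest representative, and the
vertices on shortest paths from the tokens to their representatives. -/
structure KernelData (G : SimpleGraph (Fin n)) (S : Finset (Fin n)) (d N : ℕ)
    (C : Finset (Fin n)) (δ : Fin n → Fin n → ℕ) (rep : Fin n → Fin n → Prop)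
    (path : ℕ → Fin n → Fin n → Prop) (K : Finset (Fin n)) : Prop where
  core : IsCore G d S.card C
  dist : ∀ s v r, r < N → (δ s v ≤ r ↔ ∃ l ≤ r, HasWalk G s v l)
  -- When indices are below `N`, the key `N * δ s v + v` orders by distance first and breaks ties by
  -- index, which makes the representative unique.
  rep_iff : ∀ s v, rep s v ↔ s ∈ S ∧ δ s v < 3 * S.card + 1 ∧ ¬ ∃ u : Fin n,
    nbType G C u = nbType G C v ∧ N * δ s u + u.val < N * δ s v + v.val
  path_zero : ∀ s v, path 0 s v ↔ rep s v
  path_succ : ∀ t, t + 1 < N → ∀ s v, path (t + 1) s v ↔ ∃ w, path t s w ∧ IsParent G δ s w v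
  mem : ∀ v, v ∈ K ↔ v ∈ C ∨ v ∈ S ∨ ∃ t < N, ∃ s, path t s v

end

/-- The instance on the vertex set `K`, with budget `b`. -/
noncomputable def Instance.restrict (I : Instance) (K : Finset (Fin I.n)) (b : ℕ) : Instance where
  n := K.card
  G := I.G.comap (K.orderEmbOfFin rfl)
  S := Finset.univ.filter fun v => K.orderEmbOfFin rfl v ∈ I.S
  b := b

namespace KernelData
variable {n : ℕ} {G : SimpleGraph (Fin n)} {S : Finset (Fin n)} {d N : ℕ} {C : Finset (Fin n)}
  {δ : Fin n → Fin n → ℕ} {rep : Fin n → Fin n → Prop} {path : ℕ → Fin n → Fin n → Prop}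
  {K : Finset (Fin n)} (h : KernelData G S d N C δ rep path K)
include h

/-- Passing to a parent lowers the distance by one, so `t + δ s v` is constant along a path, and it
is at most `3 * S.card` at the representative. -/
theorem path_spec {t : ℕ} (ht : t < N) {s v : Fin n} (hp : path t s v) :
    s ∈ S ∧ t + δ s v ≤ 3 * S.card := by
  induction t generalizing v with
  | zero =>
    obtain ⟨h₁, h₂, -⟩ := (h.rep_iff s v).mp ((h.path_zero s v).mp hp)
    exact ⟨h₁, by omega⟩
  | succ t ih =>
    obtain ⟨w, hw, hpar⟩ := (h.path_succ t ht s v).mp hp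
    obtain ⟨h₁, h₂⟩ := ih (by omega) hw
    have := hpar.1.2
    exact ⟨h₁, by omega⟩

theorem path_le {t : ℕ} (ht : t < N) {s v : Fin n} (hp : path t s v) : t < 3 * S.card + 1 := by
  have := (h.path_spec ht hp).2
  omega

open Classical in
-- Representatives of one token with equal types have equal keys, and the key modulo `N` is the
-- index of the vertex. Hence there is at most one per type.
theorem card_rep_le (hG : (completeBipartiteGraph (Fin d) (Fin d)).Free G) (hN : n < N)
    (s : Fin n) : (Finset.univ.filter (rep s)).card ≤
      d * (C.card + 1) ^ d + C.card ^ d * (2 * d) := by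
  refine le_trans (Finset.card_le_card_of_injOn (nbType G C)
    (fun v _ => Finset.mem_image_of_mem _ (Finset.mem_univ v)) ?_) (card_image_nbType_le hG C)
  intro u hu v hv huv
  simp only [Finset.coe_filter, Finset.mem_univ, true_and, Set.mem_ofPred_eq, h.rep_iff] at hu hv
  have h₁ : ¬ N * δ s u + u.val < N * δ s v + v.val := fun hlt => hv.2.2 ⟨u, huv, hlt⟩
  have h₂ : ¬ N * δ s v + v.val < N * δ s u + u.val := fun hlt => hu.2.2 ⟨v, huv.symm, hlt⟩
  have heq : (N * δ s u + u.val) % N = (N * δ s v + v.val) % N := by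
    congr 1; omega
  rw [Nat.mul_add_mod, Nat.mul_add_mod, Nat.mod_eq_of_lt (by omega),
    Nat.mod_eq_of_lt (by omega)] at heq
  exact Fin.ext heq

open Classical in
-- Parents are unique, so choosing for each vertex of level `t + 1` a child on level `t` is
-- injective.
theorem card_path_le {t : ℕ} (ht : t < N) (s : Fin n) :
    (Finset.univ.filter (path t s)).card ≤ (Finset.univ.filter (rep s)).card := by
  induction t with
  | zero => exact le_of_eq (by congr 1; ext v; simp [h.path_zero])
  | succ t ih =>
    refine le_trans ?_ (ih (by omega))
    have hw : ∀ v, path (t + 1) s v → ∃ w, path t s w ∧ IsParent G δ s w v :=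
      fun v => (h.path_succ t ht s v).mp
    choose! w hw₁ hw₂ using hw
    refine Finset.card_le_card_of_injOn w (fun v hv => ?_) fun u hu v hv huv => ?_
    · simp only [Finset.coe_filter, Finset.mem_univ, true_and, Set.mem_ofPred_eq] at hv ⊢
      exact hw₁ v hv
    · simp only [Finset.coe_filter, Finset.mem_univ, true_and, Set.mem_ofPred_eq] at hu hv
      exact (hw₂ u hu).unique (huv ▸ hw₂ v hv)

theorem card_le (hG : (completeBipartiteGraph (Fin d) (Fin d)).Free G) (hN : n < N) :
    K.card ≤ C.card + S.card + S.card * ((3 * S.card + 1) *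
      (d * (C.card + 1) ^ d + C.card ^ d * (2 * d))) := by
  classical
  have hsub : K ⊆ C ∪ S ∪ S.biUnion fun s =>
      ((Finset.range (3 * S.card + 1)).filter (· < N)).biUnion fun t =>
        Finset.univ.filter (path t s) := by
    intro v hv
    rcases (h.mem v).mp hv with hv | hv | ⟨t, ht, s, hp⟩
    · simp [hv]
    · simp [hv]
    · refine Finset.mem_union_right _ (Finset.mem_biUnion.mpr ⟨s, (h.path_spec ht hp).1,
        Finset.mem_biUnion.mpr ⟨t, ?_, by simpa using hp⟩⟩)
      exact Finset.mem_filter.mpr ⟨Finset.mem_range.mpr (h.path_le ht hp), ht⟩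
  refine (Finset.card_le_card hsub).trans ((Finset.card_union_le _ _).trans
    (add_le_add (Finset.card_union_le _ _) (Finset.card_biUnion_le_card_mul _ _ _ fun s _ => ?_)))
  refine (Finset.card_biUnion_le_card_mul _ _ _ fun t ht =>
    (h.card_path_le (Finset.mem_filter.mp ht).2 s).trans (h.card_rep_le hG hN s)).trans
      (Nat.mul_le_mul_right _ ((Finset.card_filter_le _ _).trans (by simp)))

theorem subset_S : S ⊆ K := fun v hv => (h.mem v).mpr (.inr (.inl hv))

theorem subset_C : C ⊆ K := fun v hv => (h.mem v).mpr (.inl hv)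

/-- The vertices on the paths can be reached by shortest paths in the subgraph induced by `K`. -/
theorem hasWalk_induced (hN : 3 * S.card < N) {m : ℕ} (e : Fin m ↪o Fin n)
    (he : ∀ v, v ∈ K ↔ v ∈ Set.range e) {t : ℕ} {s v : Fin n} (ht : t < N) (hp : path t s v) :
    ∃ s' v', e s' = s ∧ e v' = v ∧ HasWalk (G.comap e) s' v' (δ s v) := by
  generalize hδ : δ s v = l
  induction l generalizing t v with
  | zero =>
    obtain ⟨l, hl, hw⟩ := (h.dist s v 0 (by omega)).mp hδ.le
    obtain rfl : l = 0 := by omega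
    obtain rfl := hw.eq
    obtain ⟨s', rfl⟩ := (he s).mp (h.subset_S (h.path_spec ht hp).1)
    exact ⟨s', s', rfl, rfl, .refl _⟩
  | succ l ih =>
    have hspec := h.path_spec ht hp
    obtain ⟨l', hl', hw⟩ := (h.dist s v (l + 1) (by omega)).mp hδ.le
    obtain rfl : l' = l + 1 := by
      by_contra hne
      have := (h.dist s v l (by omega)).mpr ⟨l', by omega, hw⟩
      omega
    -- The penultimate vertex of a shortest walk; the parent is the smallest vertex of this kind.
    have hex : ∃ u, G.Adj u v ∧ δ s u + 1 = δ s v := by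
      obtain ⟨u, hu, hu'⟩ := hw.exists_split (i := l) (by omega)
      rw [Nat.add_sub_cancel_left, hasWalk_one_iff] at hu'
      refine ⟨u, hu', ?_⟩
      have h₁ := (h.dist s u l (by omega)).mpr ⟨l, le_rfl, hu⟩
      by_contra hne
      obtain ⟨a, ha, hwa⟩ := (h.dist s u (δ s u) (by omega)).mp le_rfl
      have := (h.dist s v l (by omega)).mpr ⟨a + 1, by omega, hwa.trans (hasWalk_one hu')⟩
      omega
    classical
    have hne : (Finset.univ.filter fun u => G.Adj u v ∧ δ s u + 1 = δ s v).Nonempty := by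
      obtain ⟨u, hu⟩ := hex
      exact ⟨u, by simpa using hu⟩
    set u := Finset.min' _ hne with hu
    have hmem := Finset.min'_mem _ hne
    rw [← hu, Finset.mem_filter] at hmem
    have hpar : IsParent G δ s v u := by
      refine ⟨hmem.2, ?_⟩
      rintro ⟨u', hlt, hu'⟩
      have := Finset.min'_le (Finset.univ.filter fun u => G.Adj u v ∧ δ s u + 1 = δ s v) u'
        (by simpa using hu')
      exact absurd hlt (not_lt.mpr this)
    -- Since `t + δ s v ≤ 3 * S.card < N` and `δ s v > 0`, there is room for another level.
    have ht' : t + 1 < N := by omega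
    obtain ⟨s', u', hs', hu', hwalk⟩ := ih ht' ((h.path_succ t ht' s u).mpr ⟨v, hp, hpar⟩)
      (by have := hmem.2.2; omega)
    obtain ⟨v', rfl⟩ := (he v).mp ((h.mem v).mpr (.inr (.inr ⟨t, ht, s, hp⟩)))
    refine ⟨s', v', hs', rfl, hwalk.trans (hasWalk_one ?_)⟩
    rw [SimpleGraph.comap_adj, hu']
    exact hmem.2.1

/-- Every vertex within distance `3 * |S|` of a token has a representative. -/
theorem exists_rep {s v : Fin n} (hs : s ∈ S) (hv : δ s v ≤ 3 * S.card)
    (hn : n < N) : ∃ u, rep s u ∧ nbType G C u = nbType G C v ∧ δ s u ≤ δ s v := by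
  classical
  have hne : (Finset.univ.filter fun u => nbType G C u = nbType G C v).Nonempty := ⟨v, by simp⟩
  obtain ⟨u, hu, hmin⟩ := Finset.exists_min_image _ (fun u => N * δ s u + u.val) hne
  have hu' : nbType G C u = nbType G C v := by simpa using hu
  have hle : δ s u ≤ δ s v := by
    have := hmin v (by simp)
    by_contra! hlt
    -- One unit of distance outweighs any difference of indices, as these are below `N`.
    have h₁ : N * (δ s v + 1) ≤ N * δ s u := Nat.mul_le_mul_left _ hlt
    have := v.isLt
    rw [Nat.mul_add] at h₁
    omega
  refine ⟨u, (h.rep_iff s u).mpr ⟨hs, by omega, ?_⟩, hu', hle⟩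
  rintro ⟨u', h₁, h₂⟩
  have := hmin u' (by simp [h₁.trans hu'])
  omega

end KernelData

/-! ### Equivalence of the restricted instance -/

theorem Slides.map {m n : ℕ} {G : SimpleGraph (Fin n)} (e : Fin m ↪o Fin n) {l : ℕ}
    {A B : Finset (Fin m)} (h : Slides (G.comap e) l A B) :
    Slides G l (A.map e.toEmbedding) (B.map e.toEmbedding) := by
  induction h with
  | refl => exact .refl _
  | step h _ ih =>
    obtain ⟨y, hy, x, hx, hadj, rfl⟩ := h
    refine .step ⟨e y, ?_, e x, ?_, hadj, ?_⟩ ih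
    · exact Finset.mem_map_of_mem _ hy
    · simpa using hx
    · rw [Finset.map_insert, Finset.map_erase]; rfl

theorem KernelData.isYes_iff {I : Instance} {d N : ℕ} {C : Finset (Fin I.n)}
    {δ : Fin I.n → Fin I.n → ℕ} {rep : Fin I.n → Fin I.n → Prop}
    {path : ℕ → Fin I.n → Fin I.n → Prop} {K : Finset (Fin I.n)}
    (h : KernelData I.G I.S d N C δ rep path K)
    (hG : (completeBipartiteGraph (Fin d) (Fin d)).Free I.G) (hn : I.n < N)
    (hN : 3 * I.S.card < N) :
    (I.restrict K (min I.b (3 * I.S.card * I.S.card))).IsYes ↔ I.IsYes := by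
  classical
  set e : Fin K.card ↪o Fin I.n := K.orderEmbOfFin rfl with he_def
  have he : ∀ v, v ∈ K ↔ v ∈ Set.range e := fun v => by
    rw [he_def, Finset.range_orderEmbOfFin]; rfl
  set S' : Finset (Fin K.card) := Finset.univ.filter fun v => e v ∈ I.S with hS'
  have hmapS : S'.map e.toEmbedding = I.S := by
    ext v
    simp only [Finset.mem_map, hS', Finset.mem_filter, Finset.mem_univ, true_and]
    constructor
    · rintro ⟨a, ha, rfl⟩; exact ha
    · intro hv
      obtain ⟨a, rfl⟩ := (he v).mp (h.subset_S hv)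
      exact ⟨a, hv, rfl⟩
  have hcardS : S'.card = I.S.card := by rw [← hmapS, Finset.card_map]
  rw [Instance.isYes_iff, Instance.isYes_iff]
  change (∃ l ≤ min I.b (3 * I.S.card * I.S.card), ∃ D, Slides (I.G.comap e) l S' D ∧
    IsDominatingSet (I.G.comap e) D) ↔ _
  constructor
  -- A solution inside `K` dominates `C ⊆ K`, hence the whole graph by the core property.
  · rintro ⟨l, hl, D, hD, hdom⟩
    refine ⟨l, hl.trans (min_le_left _ _), D.map e.toEmbedding, hmapS ▸ hD.map e, ?_⟩
    rw [isDominatingSet_iff] at hdom ⊢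
    refine h.core.dominates hG ?_ fun c hc => ?_
    · rw [Finset.card_map, hD.card_eq, hcardS]
    · obtain ⟨c', rfl⟩ := (he c).mp (h.subset_C hc)
      obtain ⟨u, hu, huc⟩ := hdom c'
      refine ⟨e u, Finset.mem_map_of_mem _ hu, ?_⟩
      rcases huc with rfl | huc
      · exact .inl rfl
      · exact .inr huc
  -- Conversely, each `v ∈ D` is replaced by the representative of its type for the token `g v`,
  -- which is no farther away and reachable inside `K`.
  · rintro ⟨l, hl, D, hD, hdom⟩
    obtain ⟨g, ℓ, hg, hgS, hw, hsum⟩ := hD.exists_walks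
    have hcardD := hD.card_eq
    have hδ : ∀ v ∈ D, δ (g v) v ≤ 3 * I.S.card ∧ δ (g v) v ≤ ℓ v := by
      intro v hv
      have h₁ : δ (g v) v ≤ 3 * I.S.card :=
        (h.dist _ _ _ hN).mpr ((hw v hv).exists_le_of_isDominatingSet hdom hcardD.le)
      refine ⟨h₁, ?_⟩
      by_contra! hlt
      have := (h.dist (g v) v (ℓ v) (by omega)).mpr ⟨_, le_rfl, hw v hv⟩
      omega
    have hr : ∀ v ∈ D, ∃ r s' r', rep (g v) r ∧ nbType I.G C r = nbType I.G C v ∧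
        δ (g v) r ≤ δ (g v) v ∧ e s' = g v ∧ e r' = r ∧
        HasWalk (I.G.comap e) s' r' (δ (g v) r) := by
      intro v hv
      obtain ⟨r, h₁, h₂, h₃⟩ := h.exists_rep (hgS v hv) (hδ v hv).1 hn
      obtain ⟨s', r', k₁, k₂, k₃⟩ := h.hasWalk_induced hN e he (t := 0) (by omega)
        ((h.path_zero _ _).mpr h₁)
      exact ⟨r, s', r', h₁, h₂, h₃, k₁, k₂, k₃⟩
    -- If `D` is empty the graph has no vertices; otherwise the types are inhabited, as `choose!`
    -- needs.
    rcases D.eq_empty_or_nonempty with hDe | ⟨v₀, hv₀⟩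
    · have hno : ∀ v : Fin I.n, False := fun v => by
        obtain ⟨u, hu, -⟩ := isDominatingSet_iff.mp hdom v
        simp [hDe] at hu
      exact ⟨0, Nat.zero_le _, S', .refl _, fun v => (hno (e v)).elim⟩
    obtain ⟨r₀, s₀, r₀', -⟩ := hr v₀ hv₀
    have : Nonempty (Fin I.n) := ⟨v₀⟩
    have : Nonempty (Fin K.card) := ⟨s₀⟩
    choose! r s' r' h₁ h₂ h₃ h₄ h₅ h₆ using hr
    obtain ⟨l', hl', D', hD', hrD'⟩ := exists_slides_of_walks (G := I.G.comap e) D r'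
      (min I.b (3 * I.S.card * I.S.card)) S' s' (fun v => δ (g v) (r v))
      (fun u hu v hv huv => hg hu hv (by rw [← h₄ u hu, ← h₄ v hv, huv]))
      (fun v hv => by simp [hS', h₄ v hv, hgS v hv]) h₆ (by
        -- The new walks are no longer than the old ones; moreover there are `I.S.card` of them,
        -- each of length at most `3 * I.S.card`.
        refine le_min ?_ ?_
        · exact (Finset.sum_le_sum fun v hv => (h₃ v hv).trans (hδ v hv).2).trans (hsum.trans hl)
        · refine (Finset.sum_le_card_nsmul D _ (3 * I.S.card) fun v hv =>
            (h₃ v hv).trans (hδ v hv).1).trans ?_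
          rw [smul_eq_mul, hcardD, mul_comm])
    refine ⟨l', hl', D', hD', isDominatingSet_iff.mpr fun v => ?_⟩
    -- Having the same type, `r u` dominates the same core vertices as `u`.
    obtain ⟨u, hu, huv⟩ := h.core.dominates hG (D := D'.map e.toEmbedding)
      (by rw [Finset.card_map, hD'.card_eq, hcardS]) (fun c hc => by
        obtain ⟨u, hu, huc⟩ := isDominatingSet_iff.mp hdom c
        have : c ∈ nbType I.G C (r u) := by
          rw [h₂ u hu]; exact mem_nbType.mpr ⟨hc, huc⟩
        refine ⟨r u, ?_, (mem_nbType.mp this).2⟩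
        rw [← h₅ u hu]
        exact Finset.mem_map_of_mem _ (hrD' u hu)) (e v)
    obtain ⟨u', hu', rfl⟩ := Finset.mem_map.mp hu
    refine ⟨u', hu', ?_⟩
    rcases huv with huv | huv
    · exact .inl (e.injective huv)
    · exact .inr huv

/-! ## The kernelization algorithm -/

/-- The term for `coreBound d k i`. -/
def coreBoundT (d : ℕ) : ℕ → Term
  | 0 => .lit (2 * d)
  | i + 1 => .add (.mul kT (coreBoundT d i)) (.lit 1)

/-- Membership in the core. -/
def coreT (x : ℕ) : Term := tab3 0 (.var x) (.lit 0) (.lit 0)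

/-- The vertex `y` is a closed neighbour of the vertices `10, …, 9 + j`. -/
def allAdjT (y : ℕ) : ℕ → Term
  | 0 => .lit 1
  | j + 1 => andT (allAdjT y j) (cadjT (10 + j) y)

/-- The vertex `y` is different from the vertices `10, …, 9 + j`. -/
def allNeT (y : ℕ) : ℕ → Term
  | 0 => .lit 1
  | j + 1 => andT (allNeT y j) (notT (eqT (.var (10 + j)) (.var y)))

/-- The number of core vertices that are smaller than the vertex `0` and closed neighbours of the
vertices `10, …, 9 + j`. -/
def commonT (j : ℕ) : Term := cardV 3 (andT (ltT (.var 3) (.var 0)) (andT (coreT 3) (allAdjT 3 j)))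

/-- The vertices `10, …, 9 + j` can be extended by at most `i` closed neighbours of the vertex `0`
to a set that is contained in too many closed neighbourhoods. -/
def fullT (d : ℕ) : ℕ → ℕ → Term
  | 0, j => notT (ltT (commonT j) (coreBoundT d (d - j)))
  | i + 1, j => orT (notT (ltT (commonT j) (coreBoundT d (d - j))))
      (sumV (10 + j) (andT (allNeT (10 + j) j) (andT (cadjT (10 + j) 0) (fullT d i (j + 1)))))

/-- Quantification over the sets `X` becomes `d` nested sums, so the term depends on `d` alone. It
consults table 0 only at vertices smaller than the current one. -/
def coreDef (d : ℕ) : Term := notT (fullT d d 0)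

/-- There is a walk of length at most `x` from the vertex `1` to the vertex `2`, where `x` is the
value of the variable `0`. -/
def reachDef : Term :=
  orT (andT (eqT (.var 0) (.lit 0)) (eqT (.var 1) (.var 2)))
    (andT (ltT (.lit 0) (.var 0))
      (sumV 5 (andT (tab3 1 (.sub (.var 0) (.lit 1)) (.var 1) (.var 5)) (cadjT 5 2))))

/-- Counts the radii below N at which the vertex is not yet reached: the distance, or N if there is
no walk. -/
def distDef : Term := .sum 5 (.ite (tab3 1 (.var 5) (.var 1) (.var 2)) (.lit 0) (.lit 1))

/-- The distance of a vertex from the vertex `1`. -/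
def distT (x : ℕ) : Term := tab3 2 (.lit 0) (.var 1) (.var x)

def keyT (x : ℕ) : Term := .add (.mul boundT (distT x)) (.var x)

def radiusT : Term := .mul (.lit 3) kT

def repDef : Term :=
  andT (memT 1) (andT (ltT (distT 2) (.add radiusT (.lit 1)))
    (notT (sumV 5 (andT
      (notT (sumV 6 (andT (coreT 6) (notT (iffT (cadjT 5 6) (cadjT 2 6))))))
      (ltT (keyT 5) (keyT 2))))))

def parentT : Term :=
  andT (andT (adjT 2 5) (eqT (.add (distT 2) (.lit 1)) (distT 5)))
    (notT (sumV 6 (andT (ltT (.var 6) (.var 2))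
      (andT (adjT 6 5) (eqT (.add (distT 6) (.lit 1)) (distT 5))))))

def pathDef : Term :=
  orT (andT (eqT (.var 0) (.lit 0)) (tab3 3 (.lit 0) (.var 1) (.var 2)))
    (andT (ltT (.lit 0) (.var 0))
      (sumV 5 (andT (tab3 4 (.sub (.var 0) (.lit 1)) (.var 1) (.var 5)) parentT)))

def keepDef : Term :=
  orT (coreT 2) (orT (memT 2) (.sum 5 (sumV 6 (tab3 4 (.var 5) (.var 6) (.var 2)))))

/-- Membership in the vertex set of the kernel. -/
def keepT (x : ℕ) : Term := tab3 5 (.lit 0) (.lit 0) (.var x)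

/-- The number of smaller vertices of the kernel. -/
def rankT (x : ℕ) : Term := cardV 7 (andT (ltT (.var 7) (.var x)) (keepT 7))

/-- The number of vertices of the kernel. -/
def sizeT : Term := cardV 7 (keepT 7)

/-- The budget of the kernel. -/
def budgetT : Term :=
  .ite (ltT (.inp (.lit 2)) (.mul radiusT kT)) (.inp (.lit 2)) (.mul radiusT kT)

/-- At a given output position, at most one pair of kernel vertices, renumbered by rank, contributes
to the sum. -/
def outAdjT : Term :=
  sumV 5 (.ite (keepT 5) (sumV 6 (.ite (keepT 6)
    (.ite (eqT (.var 2) (.add (.add (.lit 3) (.mul (rankT 5) sizeT)) (rankT 6))) (adjT 5 6)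
      (.lit 0)) (.lit 0))) (.lit 0))

def outMemT : Term :=
  sumV 5 (.ite (keepT 5)
    (.ite (eqT (.var 2) (.add (.add (.lit 3) (.mul sizeT sizeT)) (rankT 5))) (memT 5) (.lit 0))
    (.lit 0))

/-- The variable 2 is the output cell. Cell 0 holds the word length, cells 1 and 2 the number of
vertices and the budget; beyond these the adjacency and membership blocks are disjoint, so adding
them is harmless. -/
def outDef : Term :=
  .ite (eqT (.var 2) (.lit 0)) (.add (.add (.mul sizeT sizeT) sizeT) (.lit 2))
    (.ite (eqT (.var 2) (.lit 1)) sizeT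
      (.ite (eqT (.var 2) (.lit 2)) budgetT (.add outAdjT outMemT)))

/-- The whole algorithm. -/
def kernelCmd (d : ℕ) : Cmd :=
  .seq (fill 0 (coreDef d)) (.seq (fill 1 reachDef) (.seq (fill 2 distDef) (.seq (fill 3 repDef)
    (.seq (fill 4 pathDef) (.seq (fill 5 keepDef) (fill 6 outDef))))))

namespace Instance
variable (I : Instance)

/-! ### The meaning of the tables -/

open Classical in
noncomputable def coreSet (τ : Tables) : Finset (Fin I.n) :=
  Finset.univ.filter fun v => τ 0 (ix I.N v 0 0) ≠ 0
def reach (τ : Tables) (r : ℕ) (s v : Fin I.n) : Prop := τ 1 (ix I.N r s v) ≠ 0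
noncomputable def delta (τ : Tables) (s v : Fin I.n) : ℕ := τ 2 (ix I.N 0 s v)
def isRep (τ : Tables) (s v : Fin I.n) : Prop := τ 3 (ix I.N 0 s v) ≠ 0
def onPath (τ : Tables) (t : ℕ) (s v : Fin I.n) : Prop := τ 4 (ix I.N t s v) ≠ 0
open Classical in
noncomputable def keepSet (τ : Tables) : Finset (Fin I.n) :=
  Finset.univ.filter fun v => τ 5 (ix I.N 0 0 v) ≠ 0

/-- The tables after filling table `a`. -/
noncomputable def runFill (a : Fin 8) (t : Term) (τ : Tables) : Tables :=
  (fill a t).run I.encode (fun _ => 0) τ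

theorem runFill_of_ne {a a' : Fin 8} (h : a' ≠ a) (t : Term) (τ : Tables) :
    I.runFill a t τ a' = τ a' := (run_fill I.encode a t τ).1 a' h

theorem runFill_spec (a : Fin 8) (t : Term) (τ : Tables) {x y z : ℕ} (hx : x < I.N) (hy : y < I.N)
    (hz : z < I.N) : ∃ σ : Tables, I.runFill a t τ a (ix I.N x y z) = I.ev σ (env3 x y z) t ∧
      (∀ a', a' ≠ a → σ a' = τ a') ∧ ∀ i < ix I.N x y z, σ a i = I.runFill a t τ a i :=
  (run_fill I.encode a t τ).2 x hx y hy z hz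

variable {τ : Tables} {ρ : ℕ → ℕ}

theorem zero_lt_N : 0 < I.N := Nat.succ_pos _

/-- Because `n² + n + 3 > 3n`, the tables reach beyond every radius that matters. -/
theorem radius_lt_N : 3 * I.tokens < I.N := by
  have := I.tokens_le
  rw [N_eq]
  nlinarith [sq_nonneg ((I.n : ℤ) - 1), Nat.le_mul_self I.n]

@[simp] theorem ev_coreBoundT (d i : ℕ) :
    I.ev τ ρ (coreBoundT d i) = coreBound d I.tokens i := by
  induction i with
  | zero => rfl
  | succ i ih =>
    rw [coreBoundT, ev_add, ev_mul_of_le, ev_kT, ih, ev_lit, coreBound]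
    rw [ev_kT]
    exact I.tokens_le.trans I.n_lt_N.le

theorem tr_coreT {x : ℕ} {v : Fin I.n} (hx : ρ x = v) :
    I.Tr τ ρ (coreT x) ↔ v ∈ I.coreSet τ := by
  simp [Tr, coreT, hx, coreSet]

/-- The set `X` consists of the `j` distinct values of the variables `10, …, 9 + j`. -/
structure IsTuple (ρ : ℕ → ℕ) (j : ℕ) (X : Finset (Fin I.n)) : Prop where
  mem : ∀ i < j, ∃ u ∈ X, ρ (10 + i) = u
  exists_of_mem : ∀ u ∈ X, ∃ i < j, ρ (10 + i) = u
  card_eq : X.card = j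

variable {I}

theorem IsTuple.congr {j : ℕ} {X : Finset (Fin I.n)} (h : I.IsTuple ρ j X) {ρ' : ℕ → ℕ}
    (hρ : ∀ i < j, ρ' (10 + i) = ρ (10 + i)) : I.IsTuple ρ' j X :=
  ⟨fun i hi => by rw [hρ i hi]; exact h.mem i hi, fun u hu => by
    obtain ⟨i, hi, hiu⟩ := h.exists_of_mem u hu
    exact ⟨i, hi, by rw [hρ i hi, hiu]⟩, h.card_eq⟩

theorem IsTuple.insert {j : ℕ} {X : Finset (Fin I.n)} (h : I.IsTuple ρ j X) {u : Fin I.n}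
    (hu : u ∉ X) : I.IsTuple (Function.update ρ (10 + j) u) (j + 1) (insert u X) where
  mem i hi := by
    by_cases hij : i = j
    · subst hij; exact ⟨u, Finset.mem_insert_self _ _, by simp⟩
    · obtain ⟨v, hv, hiv⟩ := h.mem i (by omega)
      exact ⟨v, Finset.mem_insert_of_mem hv, by rw [Function.update_of_ne (by omega), hiv]⟩
  exists_of_mem v hv := by
    rcases Finset.mem_insert.mp hv with rfl | hv
    · exact ⟨j, by omega, by simp⟩
    · obtain ⟨i, hi, hiv⟩ := h.exists_of_mem v hv
      exact ⟨i, by omega, by rw [Function.update_of_ne (by omega), hiv]⟩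
  card_eq := by rw [Finset.card_insert_of_notMem hu, h.card_eq]

theorem IsTuple.tr_allAdjT {j : ℕ} {X : Finset (Fin I.n)} (h : I.IsTuple ρ j X) {y : ℕ}
    {v : Fin I.n} (hy : ρ y = v) :
    I.Tr τ ρ (allAdjT y j) ↔ ∀ x ∈ X, ClosedAdj I.G x v := by
  have key : ∀ j, I.Tr τ ρ (allAdjT y j) ↔ ∀ i < j, I.Tr τ ρ (cadjT (10 + i) y) := by
    intro j
    induction j with
    | zero => simp [allAdjT, Tr]
    | succ j ih => rw [allAdjT, tr_and, ih, Nat.forall_lt_succ_right]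
  rw [key]
  constructor
  · intro hall x hx
    obtain ⟨i, hi, hix⟩ := h.exists_of_mem x hx
    exact (I.tr_cadjT hix hy).mp (hall i hi)
  · intro hall i hi
    obtain ⟨x, hx, hix⟩ := h.mem i hi
    exact (I.tr_cadjT hix hy).mpr (hall x hx)

theorem IsTuple.tr_allNeT {j : ℕ} {X : Finset (Fin I.n)} (h : I.IsTuple ρ j X) {y : ℕ}
    {v : Fin I.n} (hy : ρ y = v) : I.Tr τ ρ (allNeT y j) ↔ v ∉ X := by
  have key : ∀ j, I.Tr τ ρ (allNeT y j) ↔ ∀ i < j, ρ (10 + i) ≠ v := by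
    intro j
    induction j with
    | zero => simp [allNeT, Tr]
    | succ j ih =>
      rw [allNeT, tr_and, ih, Nat.forall_lt_succ_right, tr_not, tr_eq, ev_var, ev_var, hy]
  rw [key]
  constructor
  · intro hall hv
    obtain ⟨i, hi, hiv⟩ := h.exists_of_mem v hv
    exact hall i hi hiv
  · intro hv i hi hiv
    obtain ⟨x, hx, hix⟩ := h.mem i hi
    exact hv (Fin.ext (hiv.symm.trans hix) ▸ hx)

theorem IsTuple.ev_commonT {j : ℕ} {X : Finset (Fin I.n)} (h : I.IsTuple ρ j X) {v : Fin I.n}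
    (hv : ρ 0 = v) :
    I.ev τ ρ (commonT j) = ((common I.G (I.coreSet τ) X).filter (· < v)).card := by
  classical
  rw [commonT, ev_cardV]
  congr 1
  ext u
  have h' : I.IsTuple (Function.update ρ 3 u) j X :=
    h.congr fun i _ => by rw [Function.update_of_ne (by omega)]
  simp only [Finset.mem_filter, Finset.mem_univ, true_and, tr_and, tr_lt, ev_var,
    Function.update_self, mem_common]
  rw [Function.update_of_ne (by omega), hv, I.tr_coreT (v := u) (by simp),
    h'.tr_allAdjT (v := u) (by simp), Fin.lt_def]
  tauto

/-- Generalizes over the tuple `X` chosen so far: adjacency to `v` is required only of the elements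
still to be added. -/
theorem IsTuple.tr_fullT (d : ℕ) (i : ℕ) {j : ℕ} {X : Finset (Fin I.n)} (h : I.IsTuple ρ j X)
    {v : Fin I.n} (hv : ρ 0 = v) : I.Tr τ ρ (fullT d i j) ↔
      ∃ Z : Finset (Fin I.n), X ⊆ Z ∧ (∀ z ∈ Z, z ∉ X → ClosedAdj I.G z v) ∧ Z.card ≤ j + i ∧
        coreBound d I.tokens (d - Z.card) ≤
          ((common I.G (I.coreSet τ) Z).filter (· < v)).card := by
  induction i generalizing ρ j X with
  | zero =>
    rw [fullT, tr_not, tr_lt, h.ev_commonT hv, ev_coreBoundT, not_lt]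
    constructor
    · intro hle
      exact ⟨X, subset_rfl, fun z hz hz' => absurd hz hz', h.card_eq.le, by rwa [h.card_eq]⟩
    · rintro ⟨Z, hXZ, -, hZ, hle⟩
      obtain rfl := Finset.eq_of_subset_of_card_le hXZ (by rw [h.card_eq]; exact hZ)
      rwa [h.card_eq] at hle
  | succ i ih =>
    have hrec : ∀ u : Fin I.n, u ∉ X →
        (I.Tr τ (Function.update ρ (10 + j) u) (fullT d i (j + 1)) ↔ _) := fun u hu =>
      ih (h.insert hu) (by rw [Function.update_of_ne (by omega), hv])
    have hstep : ∀ u : Fin I.n, I.Tr τ (Function.update ρ (10 + j) u)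
        (andT (allNeT (10 + j) j) (andT (cadjT (10 + j) 0) (fullT d i (j + 1)))) ↔
        u ∉ X ∧ ClosedAdj I.G u v ∧
          I.Tr τ (Function.update ρ (10 + j) u) (fullT d i (j + 1)) := fun u => by
      have h' : I.IsTuple (Function.update ρ (10 + j) u) j X :=
        h.congr fun i _ => by rw [Function.update_of_ne (by omega)]
      rw [tr_and, tr_and, h'.tr_allNeT (v := u) (by simp),
        I.tr_cadjT (u := u) (v := v) (by simp) (by rw [Function.update_of_ne (by omega), hv])]
    rw [fullT, tr_or, tr_not, tr_lt, h.ev_commonT hv, ev_coreBoundT, not_lt, tr_sumV]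
    simp only [hstep]
    constructor
    · rintro (hle | ⟨u, hu, huv, hfull⟩)
      · exact ⟨X, subset_rfl, fun z hz hz' => absurd hz hz', by rw [h.card_eq]; omega,
          by rwa [h.card_eq]⟩
      · obtain ⟨Z, hXZ, hZ, hZc, hle⟩ := (hrec u hu).mp hfull
        refine ⟨Z, (Finset.subset_insert _ _).trans hXZ, fun z hz hzX => ?_, by omega, hle⟩
        by_cases hzu : z = u
        · rw [hzu]; exact huv
        · exact hZ z hz fun hz' => (Finset.mem_insert.mp hz').elim hzu hzX
    · rintro ⟨Z, hXZ, hZ, hZc, hle⟩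
      by_cases heq : Z = X
      · left
        rwa [heq, h.card_eq] at hle
      · right
        -- Any element of `Z` outside `X` can serve as the next entry of the tuple.
        obtain ⟨u, huZ, huX⟩ := Finset.exists_of_ssubset (hXZ.ssubset_of_ne (Ne.symm heq))
        refine ⟨u, huX, hZ u huZ huX, (hrec u huX).mpr ⟨Z, ?_, ?_, by omega, hle⟩⟩
        · exact Finset.insert_subset huZ hXZ
        · exact fun z hz hz' => hZ z hz fun hzX => hz' (Finset.mem_insert_of_mem hzX)

theorem tr_coreDef (d : ℕ) {v : Fin I.n} (hv : ρ 0 = v) : I.Tr τ ρ (coreDef d) ↔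
    ¬ ∃ X : Finset (Fin I.n), X.card ≤ d ∧ (∀ x ∈ X, ClosedAdj I.G x v) ∧
      coreBound d I.tokens (d - X.card) ≤
        ((common I.G (I.coreSet τ) X).filter (· < v)).card := by
  have h0 : I.IsTuple ρ 0 ∅ := ⟨by simp, by simp, rfl⟩
  rw [coreDef, tr_not, h0.tr_fullT d d hv, not_iff_not]
  refine exists_congr fun X => ?_
  simp only [Finset.empty_subset, Finset.notMem_empty, not_false_eq_true, zero_add, true_and,
    forall_const]
  tauto

variable (I)

/-- When the entry of `v` is computed, those of smaller vertices are final, and the condition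
involves no others. This is what lets `IsCore` refer to `C` itself. -/
theorem isCore_fill (d : ℕ) (τ : Tables) :
    IsCore I.G d I.S.card (I.coreSet (I.runFill 0 (coreDef d) τ)) := by
  intro v
  set τ' := I.runFill 0 (coreDef d) τ
  obtain ⟨σ, h₁, -, h₃⟩ := I.runFill_spec 0 (coreDef d) τ (I.lt_N v) I.zero_lt_N
    I.zero_lt_N
  have h₂ : v ∈ I.coreSet τ' ↔ I.Tr σ (env3 v 0 0) (coreDef d) := by
    simp only [coreSet, Finset.mem_filter, Finset.mem_univ, true_and, Tr]
    rw [← h₁]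
  rw [h₂, tr_coreDef d (v := v) (by simp), not_iff_not]
  refine exists_congr fun X => ?_
  have : (common I.G (I.coreSet σ) X).filter (· < v) =
      (common I.G (I.coreSet τ') X).filter (· < v) := by
    ext u
    simp only [Finset.mem_filter, mem_common, and_congr_left_iff]
    intro huv hu
    simp only [coreSet, Finset.mem_filter, Finset.mem_univ, true_and]
    rw [h₃ _ (ix_lt_ix (Fin.lt_def.mp huv) I.zero_lt_N I.zero_lt_N)]
  rw [this]
  rfl

theorem update_five_zero (ρ : ℕ → ℕ) (u : ℕ) : Function.update ρ 5 u 0 = ρ 0 := rfl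
theorem update_five_one (ρ : ℕ → ℕ) (u : ℕ) : Function.update ρ 5 u 1 = ρ 1 := rfl

theorem tr_sum (x : ℕ) (t : Term) : I.Tr τ ρ (.sum x t) ↔
    ∃ i < I.N, I.Tr τ (Function.update ρ x i) t := by
  rw [Tr, ev_sum, Ne, Finset.sum_eq_zero_iff]
  simp [Tr]

theorem tr_tab3 (a : Fin 8) (e₁ e₂ e₃ : Term) : I.Tr τ ρ (tab3 a e₁ e₂ e₃) ↔
    τ a (ix I.N (I.ev τ ρ e₁) (I.ev τ ρ e₂) (I.ev τ ρ e₃)) ≠ 0 := by rw [Tr, ev_tab3]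

theorem reach_fill (τ : Tables) {r : ℕ} (hr : r < I.N) (s v : Fin I.n) :
    I.reach (I.runFill 1 reachDef τ) r s v ↔
      ∃ l ≤ r, HasWalk I.G s v l := by
  set τ' := I.runFill 1 reachDef τ
  induction r generalizing v with
  | zero =>
    obtain ⟨σ, h₁, -, h₃⟩ := I.runFill_spec 1 reachDef τ hr (I.lt_N s) (I.lt_N v)
    have h₂ : I.reach τ' 0 s v ↔ I.Tr σ (env3 0 s v) reachDef := by
      rw [reach, Tr, ← h₁]
    rw [h₂, reachDef]
    simp only [tr_or, tr_and, tr_eq, ev_var, ev_lit, env3_zero, env3_one, env3_two, tr_lt,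
      lt_irrefl, false_and, or_false, true_and]
    constructor
    · intro h
      rw [Fin.ext h]
      exact ⟨0, le_rfl, .refl v⟩
    · rintro ⟨l, hl, h⟩
      obtain rfl : l = 0 := by omega
      rw [h.eq]
  | succ r ih =>
    obtain ⟨σ, h₁, -, h₃⟩ := I.runFill_spec 1 reachDef τ hr (I.lt_N s) (I.lt_N v)
    have h₂ : I.reach τ' (r + 1) s v ↔ I.Tr σ (env3 (r + 1) s v) reachDef := by
      rw [reach, Tr, ← h₁]
    have h₄ : ∀ u : Fin I.n, σ 1 (ix I.N r s u) ≠ 0 ↔ I.reach τ' r s u := fun u => by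
      rw [h₃ _ (ix_lt_ix (by omega) (I.lt_N s) (I.lt_N u))]; rfl
    have h₅ : ∀ u : Fin I.n, I.Tr σ (Function.update (env3 (r + 1) s v) 5 u) (cadjT 5 2) ↔
        ClosedAdj I.G u v := fun u => I.tr_cadjT (by simp) (by simp)
    rw [h₂, reachDef]
    simp only [tr_or, tr_and, tr_eq, ev_var, ev_lit, env3_zero, env3_one, env3_two, tr_lt,
      tr_sumV, tr_tab3, ev_sub, h₅, Nat.succ_ne_zero, false_and, false_or, Nat.zero_lt_succ,
      true_and, update_five_zero, update_five_one, Function.update_self, Nat.add_sub_cancel, h₄,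
      ih (by omega)]
    constructor
    · rintro ⟨u, ⟨l, hl, hw⟩, hu⟩
      obtain ⟨m, hm, hw'⟩ := hu.hasWalk
      exact ⟨l + m, by omega, hw.trans hw'⟩
    · rintro ⟨l, hl, hw⟩
      by_cases hlr : l ≤ r
      · exact ⟨v, ⟨l, hlr, hw⟩, .inl rfl⟩
      · obtain rfl : l = r + 1 := by omega
        obtain ⟨u, hu, hu'⟩ := hw.exists_split (i := r) (by omega)
        rw [Nat.add_sub_cancel_left, hasWalk_one_iff] at hu'
        exact ⟨u, ⟨r, le_rfl, hu⟩, .inr hu'⟩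

end Instance

namespace Instance
variable (I : Instance) {τ : Tables} {ρ : ℕ → ℕ}

open Classical in
theorem delta_fill (τ : Tables) (s v : Fin I.n) : I.delta (I.runFill 2 distDef τ) s v =
    ((Finset.range I.N).filter fun r => ¬ I.reach τ r s v).card := by
  obtain ⟨σ, h₁, h₂, -⟩ := I.runFill_spec 2 distDef τ I.zero_lt_N (I.lt_N s) (I.lt_N v)
  rw [delta, h₁, distDef, ev_sum, Finset.card_filter]
  refine Finset.sum_congr rfl fun r _ => ?_
  rw [ev_ite, tr_tab3, h₂ 1 (by decide), ite_not]
  rfl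

/-- Reachability is monotone in the radius, so the failing radii form an initial segment. -/
theorem delta_le_iff (τ : Tables)
    (hτ : ∀ r < I.N, ∀ s v, I.reach τ r s v ↔ ∃ l ≤ r, HasWalk I.G s v l)
    (s v : Fin I.n) (r : ℕ) (hr : r < I.N) :
    I.delta (I.runFill 2 distDef τ) s v ≤ r ↔ ∃ l ≤ r, HasWalk I.G s v l := by
  classical
  rw [delta_fill, ← hτ r hr]
  constructor
  · intro hle
    by_contra hno
    have hsub : Finset.range (r + 1) ⊆
        (Finset.range I.N).filter fun r => ¬ I.reach τ r s v := by
      intro i hi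
      rw [Finset.mem_range] at hi
      refine Finset.mem_filter.mpr ⟨Finset.mem_range.mpr (by omega), fun hi' => hno ?_⟩
      obtain ⟨l, hl, hw⟩ := (hτ i (by omega) s v).mp hi'
      exact (hτ r hr s v).mpr ⟨l, by omega, hw⟩
    have := Finset.card_le_card hsub
    rw [Finset.card_range] at this
    omega
  · intro hr'
    have hsub : ((Finset.range I.N).filter fun r => ¬ I.reach τ r s v) ⊆ Finset.range r := by
      intro i hi
      rw [Finset.mem_filter, Finset.mem_range] at hi
      refine Finset.mem_range.mpr (not_le.mp fun hri => hi.2 ?_)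
      obtain ⟨l, hl, hw⟩ := (hτ r hr s v).mp hr'
      exact (hτ i hi.1 s v).mpr ⟨l, by omega, hw⟩
    simpa using Finset.card_le_card hsub

theorem ev_distT {x : ℕ} {s v : Fin I.n} (hs : ρ 1 = s) (hx : ρ x = v) :
    I.ev τ ρ (distT x) = I.delta τ s v := by
  rw [distT, ev_tab3, ev_var, ev_var, hs, hx]; rfl

theorem ev_keyT {x : ℕ} {s v : Fin I.n} (hs : ρ 1 = s) (hx : ρ x = v) :
    I.ev τ ρ (keyT x) = I.N * I.delta τ s v + v.val := by
  have hN : I.ev τ ρ boundT = I.N := rfl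
  rw [keyT, ev_add, ev_mul_of_le _ _ _ _ hN.le, hN, I.ev_distT hs hx, ev_var, hx]

@[simp] theorem ev_radiusT : I.ev τ ρ radiusT = 3 * I.tokens := by
  rw [radiusT, ev_mul_of_le _ _ _ _ (by rw [ev_lit, N_eq]; omega), ev_lit, ev_kT]

theorem coreSet_congr {τ τ' : Tables} (h : τ 0 = τ' 0) : I.coreSet τ = I.coreSet τ' := by
  simp only [coreSet, h]

theorem delta_congr {τ τ' : Tables} (h : τ 2 = τ' 2) : I.delta τ = I.delta τ' := by
  funext s v; simp only [delta, h]

theorem isRep_congr {τ τ' : Tables} (h : τ 3 = τ' 3) : I.isRep τ = I.isRep τ' := by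
  funext s v; simp only [isRep, h]

theorem onPath_congr {τ τ' : Tables} (h : τ 4 = τ' 4) : I.onPath τ = I.onPath τ' := by
  funext t s v; simp only [onPath, h]

theorem keepSet_congr {τ τ' : Tables} (h : τ 5 = τ' 5) : I.keepSet τ = I.keepSet τ' := by
  simp only [keepSet, h]

theorem isRep_fill (τ : Tables) (s v : Fin I.n) : I.isRep (I.runFill 3 repDef τ) s v ↔
    s ∈ I.S ∧ I.delta τ s v < 3 * I.S.card + 1 ∧ ¬ ∃ u : Fin I.n,
      nbType I.G (I.coreSet τ) u = nbType I.G (I.coreSet τ) v ∧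
        I.N * I.delta τ s u + u.val < I.N * I.delta τ s v + v.val := by
  obtain ⟨σ, h₁, h₂, -⟩ := I.runFill_spec 3 repDef τ I.zero_lt_N (I.lt_N s) (I.lt_N v)
  have h₃ : I.isRep (I.runFill 3 repDef τ) s v ↔ I.Tr σ (env3 0 s v) repDef := by
    rw [isRep, Tr, ← h₁]
  have hC := I.coreSet_congr (h₂ 0 (by decide))
  have hδ := I.delta_congr (h₂ 2 (by decide))
  rw [h₃, repDef, tr_and, tr_and, tr_lt, tr_not, tr_sumV, I.tr_memT (u := s) rfl,
    I.ev_distT (s := s) (v := v) rfl rfl, ev_add, ev_radiusT, ev_lit, hδ]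
  refine and_congr_right fun _ => and_congr_right fun _ => not_congr (exists_congr fun u => ?_)
  rw [tr_and, tr_not, tr_sumV, tr_lt, I.ev_keyT (s := s) (v := u) rfl rfl,
    I.ev_keyT (s := s) (v := v) rfl rfl, hδ]
  refine and_congr_left fun _ => ?_
  have : ∀ c : Fin I.n, I.Tr σ (Function.update (Function.update (env3 0 s v) 5 u) 6 c)
      (andT (coreT 6) (notT (iffT (cadjT 5 6) (cadjT 2 6)))) ↔
      c ∈ I.coreSet τ ∧ ¬ (ClosedAdj I.G u c ↔ ClosedAdj I.G v c) := fun c => by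
    rw [tr_and, tr_not, tr_iff, I.tr_coreT (v := c) rfl, hC, I.tr_cadjT (u := u) (v := c) rfl rfl,
      I.tr_cadjT (u := v) (v := c) rfl rfl]
  simp only [this, not_exists, not_and, not_not, Finset.ext_iff, mem_nbType]
  exact forall_congr' fun c => and_congr_right_iff.symm

theorem tr_parentT {s v w : Fin I.n} (hs : ρ 1 = s) (hv : ρ 2 = v) (hw : ρ 5 = w) :
    I.Tr τ ρ parentT ↔ IsParent I.G (I.delta τ) s w v := by
  rw [parentT, tr_and, tr_and, tr_not, tr_sumV, tr_eq, ev_add, I.tr_adjT hv hw, I.ev_distT hs hv,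
    I.ev_distT hs hw, ev_lit, IsParent]
  refine and_congr_right fun _ => not_congr (exists_congr fun u => ?_)
  have hs' : Function.update ρ 6 u 1 = s := hs
  have hv' : Function.update ρ 6 u 2 = v := hv
  have hw' : Function.update ρ 6 u 5 = w := hw
  rw [tr_and, tr_and, tr_eq, tr_lt, ev_add, I.tr_adjT (u := u) rfl hw',
    I.ev_distT (v := u) hs' rfl, I.ev_distT hs' hw', ev_lit, ev_var, ev_var, hv', Fin.lt_def]
  rfl

theorem onPath_fill_zero (τ : Tables) (s v : Fin I.n) :
    I.onPath (I.runFill 4 pathDef τ) 0 s v ↔ I.isRep τ s v := by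
  obtain ⟨σ, h₁, h₂, -⟩ := I.runFill_spec 4 pathDef τ I.zero_lt_N (I.lt_N s) (I.lt_N v)
  have h₃ : I.onPath (I.runFill 4 pathDef τ) 0 s v ↔ I.Tr σ (env3 0 s v) pathDef := by
    rw [onPath, Tr, ← h₁]
  rw [h₃, pathDef, ← I.isRep_congr (h₂ 3 (by decide))]
  simp only [tr_or, tr_and, tr_eq, ev_var, ev_lit, env3_zero, env3_one, env3_two, tr_lt,
    lt_irrefl, false_and, or_false, true_and, tr_tab3]
  rfl

theorem onPath_fill_succ (τ : Tables) (t : ℕ) (ht : t + 1 < I.N) (s v : Fin I.n) :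
    I.onPath (I.runFill 4 pathDef τ) (t + 1) s v ↔
      ∃ w, I.onPath (I.runFill 4 pathDef τ) t s w ∧ IsParent I.G (I.delta τ) s w v := by
  obtain ⟨σ, h₁, h₂, h₃⟩ := I.runFill_spec 4 pathDef τ ht (I.lt_N s) (I.lt_N v)
  have h₄ : I.onPath (I.runFill 4 pathDef τ) (t + 1) s v ↔ I.Tr σ (env3 (t + 1) s v) pathDef := by
    rw [onPath, Tr, ← h₁]
  have h₅ : ∀ w : Fin I.n, σ 4 (ix I.N t s w) ≠ 0 ↔ I.onPath (I.runFill 4 pathDef τ) t s w :=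
    fun w => by rw [h₃ _ (ix_lt_ix (by omega) (I.lt_N s) (I.lt_N w))]; rfl
  have h₆ : ∀ w : Fin I.n, I.Tr σ (Function.update (env3 (t + 1) s v) 5 w) parentT ↔
      IsParent I.G (I.delta τ) s w v := fun w => by
    rw [I.tr_parentT (s := s) (v := v) (w := w) rfl rfl rfl, I.delta_congr (h₂ 2 (by decide))]
  rw [h₄]
  conv_lhs => rw [pathDef]
  simp only [tr_or, tr_and, tr_eq, ev_var, ev_lit, env3_zero, env3_one, tr_lt,
    tr_sumV, tr_tab3, ev_sub, h₆, Nat.succ_ne_zero, false_and, false_or, Nat.zero_lt_succ,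
    true_and, update_five_zero, update_five_one, Function.update_self, Nat.add_sub_cancel, h₅]

theorem mem_keepSet_fill (τ : Tables) (v : Fin I.n) : v ∈ I.keepSet (I.runFill 5 keepDef τ) ↔
    v ∈ I.coreSet τ ∨ v ∈ I.S ∨ ∃ t < I.N, ∃ s, I.onPath τ t s v := by
  obtain ⟨σ, h₁, h₂, -⟩ := I.runFill_spec 5 keepDef τ I.zero_lt_N I.zero_lt_N (I.lt_N v)
  have h₃ : v ∈ I.keepSet (I.runFill 5 keepDef τ) ↔ I.Tr σ (env3 0 0 v) keepDef := by
    simp only [keepSet, Finset.mem_filter, Finset.mem_univ, true_and, Tr, h₁]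
  rw [h₃, keepDef, tr_or, tr_or, tr_sum, I.tr_coreT (v := v) rfl, I.tr_memT (u := v) rfl,
    I.coreSet_congr (h₂ 0 (by decide)), ← I.onPath_congr (h₂ 4 (by decide))]
  simp only [tr_sumV, tr_tab3]
  rfl

/-- The tables computed by the algorithm. -/
noncomputable def finalTables (d : ℕ) : Tables :=
  I.runFill 6 outDef (I.runFill 5 keepDef (I.runFill 4 pathDef (I.runFill 3 repDef
    (I.runFill 2 distDef (I.runFill 1 reachDef (I.runFill 0 (coreDef d) fun _ _ => 0))))))

theorem run_kernelCmd (d : ℕ) :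
    (kernelCmd d).run I.encode (fun _ => 0) (fun _ _ => 0) = I.finalTables d := rfl

theorem kernelData (d : ℕ) : KernelData I.G I.S d I.N (I.coreSet (I.finalTables d))
    (I.delta (I.finalTables d)) (I.isRep (I.finalTables d)) (I.onPath (I.finalTables d))
    (I.keepSet (I.finalTables d)) := by
  let τ₁ := I.runFill 0 (coreDef d) fun _ _ => 0
  let τ₂ := I.runFill 1 reachDef τ₁
  let τ₃ := I.runFill 2 distDef τ₂
  let τ₄ := I.runFill 3 repDef τ₃
  let τ₅ := I.runFill 4 pathDef τ₄
  let τ₆ := I.runFill 5 keepDef τ₅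
  -- Each filling changes only its own table, so every table keeps its contents to the end.
  have e₆ : ∀ a, a ≠ 6 → I.finalTables d a = τ₆ a := fun a h => I.runFill_of_ne h _ _
  have e₅ : ∀ a, a ≠ 5 → τ₆ a = τ₅ a := fun a h => I.runFill_of_ne h _ _
  have e₄ : ∀ a, a ≠ 4 → τ₅ a = τ₄ a := fun a h => I.runFill_of_ne h _ _
  have e₃ : ∀ a, a ≠ 3 → τ₄ a = τ₃ a := fun a h => I.runFill_of_ne h _ _
  have e₂ : ∀ a, a ≠ 2 → τ₃ a = τ₂ a := fun a h => I.runFill_of_ne h _ _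
  have e₁ : ∀ a, a ≠ 1 → τ₂ a = τ₁ a := fun a h => I.runFill_of_ne h _ _
  have keep_eq : I.keepSet (I.finalTables d) = I.keepSet τ₆ :=
    I.keepSet_congr (e₆ 5 (by decide))
  have path_eq₅ : I.onPath (I.finalTables d) = I.onPath τ₅ :=
    I.onPath_congr ((e₆ 4 (by decide)).trans (e₅ 4 (by decide)))
  have rep_eq₄ : I.isRep (I.finalTables d) = I.isRep τ₄ :=
    I.isRep_congr ((e₆ 3 (by decide)).trans ((e₅ 3 (by decide)).trans (e₄ 3 (by decide))))
  have delta_eq₄ : I.delta (I.finalTables d) = I.delta τ₄ :=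
    I.delta_congr ((e₆ 2 (by decide)).trans ((e₅ 2 (by decide)).trans (e₄ 2 (by decide))))
  have delta_eq₃ : I.delta (I.finalTables d) = I.delta τ₃ :=
    delta_eq₄.trans (I.delta_congr (e₃ 2 (by decide)))
  have core_eq₅ : I.coreSet (I.finalTables d) = I.coreSet τ₅ :=
    I.coreSet_congr ((e₆ 0 (by decide)).trans (e₅ 0 (by decide)))
  have core_eq₃ : I.coreSet (I.finalTables d) = I.coreSet τ₃ :=
    core_eq₅.trans (I.coreSet_congr ((e₄ 0 (by decide)).trans (e₃ 0 (by decide))))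
  have core_eq₁ : I.coreSet (I.finalTables d) = I.coreSet τ₁ :=
    core_eq₃.trans (I.coreSet_congr ((e₂ 0 (by decide)).trans (e₁ 0 (by decide))))
  refine ⟨?_, ?_, ?_, ?_, ?_, ?_⟩
  · rw [core_eq₁]
    exact I.isCore_fill d _
  · rw [delta_eq₃]
    exact I.delta_le_iff τ₂ fun r hr s v => I.reach_fill τ₁ hr s v
  · rw [rep_eq₄, core_eq₃, delta_eq₃]
    exact I.isRep_fill τ₃
  · rw [path_eq₅, rep_eq₄]
    exact I.onPath_fill_zero τ₄
  · rw [path_eq₅, delta_eq₄]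
    exact I.onPath_fill_succ τ₄
  · rw [keep_eq, core_eq₅, path_eq₅]
    exact I.mem_keepSet_fill τ₅

/-! ### The output -/

/-- The kernel. -/
noncomputable def kernel (d : ℕ) : Instance :=
  I.restrict (I.keepSet (I.finalTables d)) (min I.b (3 * I.S.card * I.S.card))

theorem tr_keepT {x : ℕ} {v : Fin I.n} (hx : ρ x = v) :
    I.Tr τ ρ (keepT x) ↔ v ∈ I.keepSet τ := by
  simp [Tr, keepT, hx, keepSet]

theorem ev_sizeT : I.ev τ ρ sizeT = (I.keepSet τ).card := by
  classical
  rw [sizeT, ev_cardV]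
  congr 1
  ext u
  rw [Finset.mem_filter, I.tr_keepT (v := u) (by simp)]
  simp

theorem ev_rankT {x : ℕ} (hx7 : x ≠ 7) {v : Fin I.n} (hx : ρ x = v) :
    I.ev τ ρ (rankT x) = ((I.keepSet τ).filter (· < v)).card := by
  classical
  rw [rankT, ev_cardV]
  congr 1
  ext u
  rw [Finset.mem_filter, Finset.mem_filter, tr_and, tr_lt, ev_var, ev_var,
    I.tr_keepT (v := u) (by simp), Function.update_self, Function.update_of_ne hx7, hx, Fin.lt_def]
  simp [and_comm]

/-- Rank inverts the increasing enumeration of `K`, so the ranks computed by the algorithm are the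
vertex names in `restrict`. -/
theorem card_filter_lt_orderEmbOfFin {n : ℕ} (K : Finset (Fin n)) (i : Fin K.card) :
    (K.filter (· < K.orderEmbOfFin rfl i)).card = i := by
  have : K.filter (· < K.orderEmbOfFin rfl i) =
      (Finset.Iio i).map (K.orderEmbOfFin rfl).toEmbedding := by
    ext v
    simp only [Finset.mem_filter, Finset.mem_map, Finset.mem_Iio]
    constructor
    · rintro ⟨hv, hlt⟩
      obtain ⟨j, rfl⟩ : v ∈ Set.range (K.orderEmbOfFin rfl) := by
        rw [Finset.range_orderEmbOfFin]; exact hv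
      exact ⟨j, (K.orderEmbOfFin rfl).lt_iff_lt.mp hlt, rfl⟩
    · rintro ⟨j, hj, rfl⟩
      exact ⟨Finset.orderEmbOfFin_mem _ _ _, (K.orderEmbOfFin rfl).lt_iff_lt.mpr hj⟩
  rw [this, Finset.card_map, Fin.card_Iio]

theorem sum_ite_mem_orderEmbOfFin {n : ℕ} (K : Finset (Fin n)) (f : Fin n → ℕ)
    [DecidablePred (· ∈ K)] :
    ∑ u, (if u ∈ K then f u else 0) = ∑ i : Fin K.card, f (K.orderEmbOfFin rfl i) := by
  rw [← Finset.sum_filter]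
  have : Finset.univ.filter (· ∈ K) = Finset.univ.map (K.orderEmbOfFin rfl).toEmbedding := by
    rw [Finset.map_orderEmbOfFin_univ]; ext; simp
  rw [this, Finset.sum_map]
  rfl

theorem card_keepSet_le (τ : Tables) : (I.keepSet τ).card ≤ I.n := by
  simpa using Finset.card_le_univ (I.keepSet τ)

open Classical in
theorem ev_outAdjT {p : ℕ} (hp : ρ 2 = p) : I.ev τ ρ outAdjT =
    ∑ i : Fin (I.keepSet τ).card, ∑ j : Fin (I.keepSet τ).card,
      if p = 3 + i.val * (I.keepSet τ).card + j.val then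
        if I.G.Adj ((I.keepSet τ).orderEmbOfFin rfl i) ((I.keepSet τ).orderEmbOfFin rfl j)
          then 1 else 0
      else 0 := by
  set K := I.keepSet τ with hK
  have h₁ : I.ev τ ρ outAdjT = ∑ u : Fin I.n, if u ∈ K then ∑ v : Fin I.n, if v ∈ K then
      (if p = 3 + (K.filter (· < u)).card * K.card + (K.filter (· < v)).card then
        if I.G.Adj u v then 1 else 0 else 0) else 0 else 0 := by
    rw [outAdjT, ev_sumV]
    refine Finset.sum_congr rfl fun u _ => ?_
    rw [ev_ite, ev_lit, ev_sumV]
    refine if_congr (I.tr_keepT rfl) (Finset.sum_congr rfl fun v _ => ?_) rfl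
    set ρ' := Function.update (Function.update ρ 5 u) 6 v
    have h5 : ρ' 5 = u := rfl
    have h6 : ρ' 6 = v := rfl
    have h2 : ρ' 2 = p := hp
    rw [ev_ite, ev_ite, ev_lit, I.ev_adjT h5 h6]
    have hr : I.ev τ ρ' (rankT 5) ≤ I.N := by
      rw [I.ev_rankT (by omega) h5]
      exact (Finset.card_filter_le _ _).trans ((I.card_keepSet_le τ).trans I.n_lt_N.le)
    have he : I.Tr τ ρ' (eqT (.var 2) (.add (.add (.lit 3) (.mul (rankT 5) sizeT)) (rankT 6))) ↔
        p = 3 + (K.filter (· < u)).card * K.card + (K.filter (· < v)).card := by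
      rw [tr_eq, ev_add, ev_add, ev_mul_of_le _ _ _ _ hr, I.ev_rankT (by omega) h5,
        I.ev_rankT (by omega) h6, ev_sizeT, ev_lit, ev_var, h2]
    simp only [he, I.tr_keepT h6, ← hK]
  rw [h₁, sum_ite_mem_orderEmbOfFin]
  refine Finset.sum_congr rfl fun i _ => ?_
  rw [sum_ite_mem_orderEmbOfFin]
  simp only [card_filter_lt_orderEmbOfFin]

open Classical in
theorem ev_outMemT {p : ℕ} (hp : ρ 2 = p) : I.ev τ ρ outMemT =
    ∑ i : Fin (I.keepSet τ).card,
      if p = 3 + (I.keepSet τ).card * (I.keepSet τ).card + i.val then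
        if (I.keepSet τ).orderEmbOfFin rfl i ∈ I.S then 1 else 0
      else 0 := by
  set K := I.keepSet τ with hK
  have h₁ : I.ev τ ρ outMemT = ∑ u : Fin I.n, if u ∈ K then
      (if p = 3 + K.card * K.card + (K.filter (· < u)).card then
        if u ∈ I.S then 1 else 0 else 0) else 0 := by
    rw [outMemT, ev_sumV]
    refine Finset.sum_congr rfl fun u _ => ?_
    set ρ' := Function.update ρ 5 u
    have h5 : ρ' 5 = u := rfl
    have h2 : ρ' 2 = p := hp
    rw [ev_ite, ev_ite, ev_lit, I.ev_memT h5]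
    have hr : I.ev τ ρ' sizeT ≤ I.N := by
      rw [ev_sizeT]
      exact (I.card_keepSet_le τ).trans I.n_lt_N.le
    have he : I.Tr τ ρ' (eqT (.var 2) (.add (.add (.lit 3) (.mul sizeT sizeT)) (rankT 5))) ↔
        p = 3 + K.card * K.card + (K.filter (· < u)).card := by
      rw [tr_eq, ev_add, ev_add, ev_mul_of_le _ _ _ _ hr, I.ev_rankT (by omega) h5,
        ev_sizeT, ev_lit, ev_var, h2]
    simp only [he, I.tr_keepT h5, ← hK]
  rw [h₁, sum_ite_mem_orderEmbOfFin]
  simp only [card_filter_lt_orderEmbOfFin]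

theorem ev_budgetT : I.ev τ ρ budgetT = min I.b (3 * I.S.card * I.S.card) := by
  classical
  have hq : I.ev τ ρ (.mul radiusT kT) = 3 * I.S.card * I.S.card := by
    rw [ev_mul_of_le _ _ _ _ (by rw [ev_radiusT]; exact I.radius_lt_N.le), ev_radiusT, ev_kT]
    rfl
  have hb : I.ev τ ρ (.inp (.lit 2)) = I.b := rfl
  rw [budgetT, ev_ite, tr_lt, hq, hb]
  split_ifs <;> omega

open Classical in
theorem load_encode_restrict_mem (K : Finset (Fin I.n)) (b : ℕ) (i : Fin K.card) :
    load (I.restrict K b).encode (3 + K.card * K.card + i.val) =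
      if K.orderEmbOfFin rfl i ∈ I.S then 1 else 0 := by
  have hS : i ∈ (I.restrict K b).S ↔ K.orderEmbOfFin rfl i ∈ I.S :=
    Finset.mem_filter.trans ⟨fun h => h.2, fun h => ⟨Finset.mem_univ _, h⟩⟩
  refine ((I.restrict K b).load_encode_mem i).trans ?_
  by_cases hs : K.orderEmbOfFin rfl i ∈ I.S
  · rw [if_pos hs]; exact if_pos (hS.mpr hs)
  · rw [if_neg hs]; exact if_neg (mt hS.mp hs)

theorem finalTables_out (d : ℕ) {p : ℕ} (hp : p ≤ (I.kernel d).encode.length) :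
    I.finalTables d 6 p = load (I.kernel d).encode p := by
  classical
  set K := I.keepSet (I.finalTables d) with hK
  have hlen : (I.kernel d).encode.length = K.card * K.card + K.card + 2 :=
    (I.kernel d).length_encode
  have hKn : K.card ≤ I.n := I.card_keepSet_le _
  have hpN : p < I.N := by
    rw [N_eq]
    have := Nat.mul_le_mul hKn hKn
    omega
  -- Since `ix N 0 0 p = p`, the first N cells of table 6 are read off in order.
  obtain ⟨σ, h₁, h₂, -⟩ := I.runFill_spec 6 outDef _ I.zero_lt_N I.zero_lt_N hpN
  have h₃ : I.finalTables d 6 p = I.ev σ (env3 0 0 p) outDef := by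
    rw [← h₁]
    simp only [ix, mul_zero, zero_add]
    rfl
  have hKσ : I.keepSet σ = K := by
    rw [hK]
    refine I.keepSet_congr ((h₂ 5 (by decide)).trans ?_)
    exact (I.runFill_of_ne (by decide) _ _).symm
  have hsz : I.ev σ (env3 0 0 p) sizeT = K.card := by rw [ev_sizeT, hKσ]
  have hmul : I.ev σ (env3 0 0 p) (.mul sizeT sizeT) = K.card * K.card := by
    rw [ev_mul_of_le _ _ _ _ (by rw [hsz]; exact hKn.trans I.n_lt_N.le), hsz]
  rw [h₃, outDef]
  simp only [ev_ite, tr_eq, ev_var, ev_lit, env3_two, ev_add, hsz, hmul, ev_budgetT,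
    I.ev_outAdjT (ρ := env3 0 0 p) (p := p) rfl, I.ev_outMemT (ρ := env3 0 0 p) (p := p) rfl]
  rw [hKσ]
  by_cases hp0 : p = 0
  · rw [if_pos hp0, hp0]; exact hlen.symm
  by_cases hp1 : p = 1
  · rw [if_neg hp0, if_pos hp1, hp1]; rfl
  by_cases hp2 : p = 2
  · rw [if_neg hp0, if_neg hp1, if_pos hp2, hp2]; rfl
  rw [if_neg hp0, if_neg hp1, if_neg hp2]
  have hlt : ∀ i j : Fin K.card, i.val * K.card + j.val < K.card * K.card := fun i j => by
    have h₁ := Nat.mul_le_mul_right K.card (Nat.succ_le_iff.mpr i.isLt)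
    have h₂ := j.isLt
    rw [Nat.succ_mul] at h₁
    omega
  by_cases hlo : p < 3 + K.card * K.card
  · have hKpos : 0 < K.card := Nat.pos_of_ne_zero fun h => by rw [h] at hlo; omega
    -- Row and column of the adjacency matrix are quotient and remainder of `p - 3`.
    let i₀ : Fin K.card := ⟨(p - 3) / K.card, Nat.div_lt_of_lt_mul (by omega)⟩
    let j₀ : Fin K.card := ⟨(p - 3) % K.card, Nat.mod_lt _ hKpos⟩
    have hp' : p = 3 + i₀.val * K.card + j₀.val := by
      have := Nat.div_add_mod' (p - 3) K.card
      simp only [i₀, j₀]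
      omega
    have huniq : ∀ i j : Fin K.card, p = 3 + i.val * K.card + j.val → i = i₀ ∧ j = j₀ := by
      intro i j h
      have h' : p - 3 = K.card * i.val + j.val := by rw [mul_comm]; omega
      constructor
      · apply Fin.ext
        simp only [i₀, h', Nat.mul_add_div hKpos, Nat.div_eq_of_lt j.isLt, add_zero]
      · apply Fin.ext
        simp only [j₀, h', Nat.mul_add_mod, Nat.mod_eq_of_lt j.isLt]
    have hmem : ∀ i : Fin K.card, p ≠ 3 + K.card * K.card + i.val := fun i h => by omega
    rw [Finset.sum_eq_single i₀, Finset.sum_eq_single j₀, if_pos hp',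
      Finset.sum_eq_zero fun i _ => if_neg (hmem i), add_zero]
    · rw [hp']
      exact ((I.kernel d).load_encode_adj i₀ j₀).symm
    · intro j _ hj
      exact if_neg fun h => hj (huniq _ _ h).2
    · simp
    · intro i _ hi
      exact Finset.sum_eq_zero fun j _ => if_neg fun h => hi (huniq _ _ h).1
    · simp
  · let i₀ : Fin K.card := ⟨p - 3 - K.card * K.card, by omega⟩
    have hp' : p = 3 + K.card * K.card + i₀.val := by simp only [i₀]; omega
    have hadj : ∀ i j : Fin K.card, p ≠ 3 + i.val * K.card + j.val := fun i j h => by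
      have := hlt i j
      omega
    rw [Finset.sum_eq_zero fun i _ => Finset.sum_eq_zero fun j _ => if_neg (hadj i j), zero_add,
      Finset.sum_eq_single i₀, if_pos hp']
    · rw [hp']
      exact (I.load_encode_restrict_mem K _ i₀).symm
    · intro i _ hi
      refine if_neg fun h => hi (Fin.ext ?_)
      omega
    · simp

end Instance

/-! ## The size of the kernel -/

theorem nat_size_le_self (m : ℕ) : Nat.size m ≤ m := Nat.size_le.mpr Nat.lt_two_pow_self

theorem sum_map_le_length_mul {α : Type*} (l : List α) (f : α → ℕ) (c : ℕ) (h : ∀ a ∈ l, f a ≤ c) :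
    (l.map f).sum ≤ l.length * c := by
  simpa using List.sum_le_card_nsmul (l.map f) c (by simpa using h)

/-- All letters except the first two are 0 or 1 and contribute at most 2 each. -/
theorem Instance.size_le (I : Instance) :
    I.size ≤ I.n + I.b + 2 + 2 * (I.n * I.n + I.n) := by
  have hmem : ∀ a ∈ I.encode.drop 2, Nat.size a + 1 ≤ 2 := by
    intro a ha
    have : a ≤ 1 := by
      simp only [encode, List.drop_succ_cons, List.drop_zero, List.mem_append, List.mem_flatMap,
        List.mem_map, List.mem_finRange, true_and] at ha
      rcases ha with ⟨u, v, rfl⟩ | ⟨v, rfl⟩ <;> split_ifs <;> omega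
    have := nat_size_le_self a
    omega
  have h₁ := nat_size_le_self I.n
  have h₂ := nat_size_le_self I.b
  have h₃ := sum_map_le_length_mul _ _ 2 hmem
  rw [List.length_drop, length_encode, Nat.add_sub_cancel] at h₃
  have h₄ : I.size = Nat.size I.n + 1 + (Nat.size I.b + 1 +
      ((I.encode.drop 2).map fun a => Nat.size a + 1).sum) := rfl
  omega

open Polynomial in
/-- The bound `coreBound d k i` as a polynomial in `k`. -/
noncomputable def coreBoundPoly (d : ℕ) : ℕ → ℕ[X]
  | 0 => C (2 * d)
  | i + 1 => X * coreBoundPoly d i + 1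

theorem eval_coreBoundPoly (d k i : ℕ) : (coreBoundPoly d i).eval k = coreBound d k i := by
  induction i with
  | zero => simp [coreBoundPoly, coreBound]
  | succ i ih => simp [coreBoundPoly, coreBound, ih]

open Polynomial in
/-- A bound for the number of vertices of the kernel. -/
noncomputable def kernelPoly (d : ℕ) : ℕ[X] :=
  coreBoundPoly d d + X + X * ((C 3 * X + 1) *
    (C d * (coreBoundPoly d d + 1) ^ d + coreBoundPoly d d ^ d * C (2 * d)))

theorem Instance.kernel_n_le (I : Instance) {d : ℕ}
    (hG : (completeBipartiteGraph (Fin d) (Fin d)).Free I.G) :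
    (I.kernel d).n ≤ (kernelPoly d).eval I.tokens := by
  have h := (I.kernelData d).card_le hG I.n_lt_N
  have hC := (I.kernelData d).core.card_le
  simp only [kernelPoly, Polynomial.eval_add, Polynomial.eval_mul, Polynomial.eval_pow,
    Polynomial.eval_X, Polynomial.eval_C, Polynomial.eval_one, eval_coreBoundPoly]
  refine h.trans ?_
  unfold Instance.tokens
  gcongr

open Polynomial in
/-- A bound for the size of the kernel. -/
noncomputable def kernelSizePoly (d : ℕ) : ℕ[X] :=
  kernelPoly d + C 3 * X * X + C 2 + C 2 * (kernelPoly d * kernelPoly d + kernelPoly d)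

theorem Instance.kernel_size_le (I : Instance) {d : ℕ}
    (hG : (completeBipartiteGraph (Fin d) (Fin d)).Free I.G) :
    (I.kernel d).size ≤ (kernelSizePoly d).eval I.tokens ∧
      (I.kernel d).tokens ≤ (kernelSizePoly d).eval I.tokens := by
  have h₁ := (I.kernel d).size_le
  have h₂ := I.kernel_n_le hG
  have h₃ := (I.kernel d).tokens_le
  have h₄ : (I.kernel d).b ≤ 3 * I.tokens * I.tokens := min_le_right _ _
  have h₅ := Nat.mul_le_mul h₂ h₂
  simp only [kernelSizePoly, Polynomial.eval_add, Polynomial.eval_mul,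
    Polynomial.eval_X, Polynomial.eval_C]
  omega

end DSDiscovery

theorem mainTheorem4 (𝒞 : DSDiscovery.GraphClass) (h𝒞 : 𝒞.BicliqueFree) :
    DSDiscovery.HasPolynomialKernelOn 𝒞 := by
  obtain ⟨d, hd⟩ := h𝒞
  obtain ⟨P, p, hP⟩ := (DSDiscovery.kernelCmd d).exists_program 6
  refine ⟨P, fun I => I.kernel d, p, DSDiscovery.kernelSizePoly d, fun I hI => ?_⟩
  have hG := hd I.n I.G hI
  have hsize := I.kernel_size_le hG
  refine ⟨hP _ _ ?_ fun i hi => ?_, ?_, hsize.1, hsize.2, ?_⟩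
  -- Only `w.length + 1` cells are copied out, so the kernel's encoding must not be longer than the
  -- input.
  · have hn : (I.kernel d).n ≤ I.n := I.card_keepSet_le _
    have := Nat.mul_le_mul hn hn
    change (I.kernel d).encode.length ≤ _
    rw [DSDiscovery.Instance.length_encode, DSDiscovery.Instance.length_encode]
    omega
  · rw [DSDiscovery.Instance.run_kernelCmd]
    exact I.finalTables_out d hi
  · exact (I.kernelData d).isYes_iff hG I.n_lt_N I.radius_lt_N
  · exact ⟨I.n, I.G, hI, ⟨SimpleGraph.Embedding.comap
      ((I.keepSet (I.finalTables d)).orderEmbOfFin rfl).toEmbedding I.G⟩⟩
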